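/- **Proposition.** The composition in the category of reduced orbifolds is well-defined, in the following sense. *Conventions.* A reduced orbifold is a second-countable Hausdorff space $Q$ with a maximal set $\mathcal U$ of pairwise compatible charts whose images cover $Q$. A chart $(V,G,\pi)$ consists of a connected smooth $n$-manifold $V$, a finite subgroup $G\subseteq\mathrm{Diff}(V)$, and a map $\pi\colon V\to Q$ with open image that induces a homeomorphism $G\backslash V\to\pi(V)$. Charts are compatible if any two points over the same point of $Q$ are matched by a diffeomorphism between open neighbourhoods that commutes with the projections to $Q$. A representative of $\mathcal U$ is an indexed family $\mathcal V=\{(V_i,G_i,\pi_i)\}_{i\in I}$ of charts in $\mathcal U$ whose images cover $Q$. $\Psi(\mathcal V)$ denotes the set of diffeomorphisms between open subsets of $\coprod_i V_i$ commuting with $\coprod_i\pi_i$; a change of charts is an element of $\Psi(\mathcal V)$ whose domain and codomain each lie in a single chart. *Charted orbifold maps.* Let $\mathcal V,\mathcal V'$ be representatives of $\mathcal U,\mathcal U'$. A charted orbifold map $\hat f\colon\mathcal V\to\mathcal V'$ is an equivalence class of tuples $(f,\{\tilde f_i\}_{i\in I},P,\nu)$ with the following data: $f\colon Q\to Q'$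 is continuous; each $\tilde f_i\colon V_i\to V'_{\alpha(i)}$ is a smooth lift of $f$; $P\subseteq\Psi(\mathcal V)$ is a set of changes of charts that is closed under inversion and composition at the level of germs, and such that every germ of an element of $\Psi(\mathcal V)$ is a germ of an element of $P$; $\nu$ assigns to each $\lambda\in P$ an element $\nu(\lambda)$ of $\Psi(\mathcal V')$ which is an open embedding between charts in $\mathcal U'$ (namely, from a chart in $\mathcal U'$ embedded as an open subset of some $V'_j$ into some $V'_k$). With $\psi=\coprod_i\tilde f_i$ it is required that $\psi\circ\lambda=\nu(\lambda)\circ\psi|_{\mathrm{dom}\,\lambda}$, and that the assignment $\mathrm{germ}_x\lambda\mapsto\mathrm{germ}_{\psi(x)}\nu(\lambda)$ be well defined, multiplicative and unital. Two tuples are equivalent if $f$, all $\tilde f_i$, and the induced assignments of germs coincide. *Composition of charted orbifold maps.* For $\hat f\colon\mathcal V\to\mathcal V'$ and $\hat g\colon\mathcal V'\to\mathcal V''$ the composition $\hat g\circ\hat f$ is given by composing the continuous maps, the lifts $\tilde g_{\alpha(i)}\circ\tilde f_i$, and the assignments of germs (after shrinking domains). *Lifts of the identity.* A lift of the identity of $(Q,\mathcal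 U)$ is a charted orbifold map between representatives of $\mathcal U$ with $f=\mathrm{id}_Q$ all of whose $\tilde f_i$ are local diffeomorphisms. *Orbifold maps.* Let $\hat f_j\colon\mathcal V_j\to\mathcal V'_j$ ($j=1,2$) be charted orbifold maps from $(Q,\mathcal U)$ to $(Q',\mathcal U')$. Then $\hat f_1\sim\hat f_2$ if there are representatives $\mathcal W,\mathcal W'$ of $\mathcal U,\mathcal U'$, lifts of the identity $\varepsilon_j\colon\mathcal W\to\mathcal V_j$ and $\varepsilon'_j\colon\mathcal W'\to\mathcal V'_j$, and a charted orbifold map $\hat h\colon\mathcal W\to\mathcal W'$ with $\hat f_j\circ\varepsilon_j=\varepsilon'_j\circ\hat h$ for $j=1,2$. An orbifold map $(Q,\mathcal U)\to(Q',\mathcal U')$ is a class $[\hat f]$ of charted orbifold maps with respect to $\sim$. *Statement.* Let $(Q,\mathcal U)$, $(Q',\mathcal U')$, $(Q'',\mathcal U'')$ be reduced orbifolds. (1) For all charted orbifold maps $\hat f\colon\mathcal V\to\mathcal V'$ from $(Q,\mathcal U)$ to $(Q',\mathcal U')$ and $\hat g\colon\mathcal W'\to\mathcal W''$ from $(Q',\mathcal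 U')$ to $(Q'',\mathcal U'')$ there are representatives $\mathcal K,\mathcal K',\mathcal K''$ of $\mathcal U,\mathcal U',\mathcal U''$, lifts of the respective identities $$\varepsilon\colon\mathcal K\to\mathcal V,\quad \varepsilon_1'\colon\mathcal K'\to\mathcal V',\quad \varepsilon_2'\colon\mathcal K'\to\mathcal W',\quad \varepsilon''\colon\mathcal K''\to\mathcal W'',$$ and charted orbifold maps $\hat h\colon\mathcal K\to\mathcal K'$, $\hat k\colon\mathcal K'\to\mathcal K''$ such that $$\hat f\circ\varepsilon=\varepsilon'_1\circ\hat h,\qquad \hat g\circ\varepsilon'_2=\varepsilon''\circ\hat k.\tag{$*$}$$ (2) There is a unique map $(\Gamma,\Phi)\mapsto\Gamma\circ\Phi$, assigning to orbifold maps $\Phi\colon(Q,\mathcal U)\to(Q',\mathcal U')$ and $\Gamma\colon(Q',\mathcal U')\to(Q'',\mathcal U'')$ an orbifold map $(Q,\mathcal U)\to(Q'',\mathcal U'')$, such that $$\Gamma\circ\Phi=[\hat k\circ\hat h]$$ for all representatives $\hat f\in\Phi$, $\hat g\in\Gamma$ and all choices of data $\mathcal K,\mathcal K',\mathcal K'',\varepsilon,\varepsilon'_1,\varepsilon'_2,\varepsilon'',\hat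 h,\hat k$ as in (1) satisfying $(*)$. That is, the class $[\hat k\circ\hat h]$ does not depend on any of these choices. -/

import Mathlib

open scoped Manifold ContDiff Topology

universe u

namespace RedOrb

/-- The smooth structure of a disjoint union: the charts of each piece are charts of the union. -/
noncomputable instance sigmaChartedSpace {H : Type*} [TopologicalSpace H] [Nonempty H]
    {ι : Type*} {M : ι → Type*} [∀ i, TopologicalSpace (M i)] [∀ i, ChartedSpace H (M i)] :
    ChartedSpace H (Σ i, M i) where
  atlas := ⋃ i, (fun e : OpenPartialHomeomorph (M i) H =>
    e.lift_openEmbedding (Topology.IsOpenEmbedding.sigmaMk (σ := M) (i := i))) '' atlas H (M i)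
  chartAt x := (chartAt H x.2).lift_openEmbedding
    (Topology.IsOpenEmbedding.sigmaMk (σ := M) (i := x.1))
  mem_chart_source x := by
    rw [OpenPartialHomeomorph.lift_openEmbedding_source]
    exact ⟨x.2, mem_chart_source H x.2, rfl⟩
  chart_mem_atlas x := Set.mem_iUnion.2 ⟨x.1, chartAt H x.2, chart_mem_atlas H x.2, rfl⟩

/-! ### Reduced orbifolds -/

/-- A reduced orbifold chart `(V, G, π)` of dimension `n` on `Q`: a connected smooth `n`-manifold
`V`, a finite subgroup `G` of `Diff(V)` and a map `π : V → Q` with open image which induces a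
homeomorphism from `G \ V` onto `π(V)`; that is, `π` is continuous and open and its fibres are
exactly the `G`-orbits. -/
structure OrbChart (n : ℕ) (Q : Type u) [TopologicalSpace Q] where
  V : Type u
  [topV : TopologicalSpace V]
  [chartedV : ChartedSpace (EuclideanSpace ℝ (Fin n)) V]
  [manifoldV : IsManifold (𝓡 n) ∞ V]
  [t2V : T2Space V]
  [secondCountableV : SecondCountableTopology V]
  [connectedV : ConnectedSpace V]
  G : Subgroup (V ≃ₜ V)
  finite_G : Finite G
  /-- As `G` is closed under inverses, its elements are diffeomorphisms. -/
  smooth_G : ∀ g ∈ G, ContMDiff (𝓡 n) (𝓡 n) ∞ g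
  π : V → Q
  continuous_π : Continuous π
  isOpenMap_π : IsOpenMap π
  π_eq_iff : ∀ x y : V, π x = π y ↔ ∃ g ∈ G, g x = y

attribute [instance] OrbChart.topV OrbChart.chartedV OrbChart.manifoldV OrbChart.t2V
  OrbChart.secondCountableV OrbChart.connectedV

section Structures

variable {n : ℕ} {Q : Type u} [TopologicalSpace Q]

/-- Two orbifold charts are compatible if points with the same image in `Q` are matched by a
diffeomorphism between open neighbourhoods which commutes with the projections to `Q`. -/
def OrbChart.Compatible (c d : OrbChart n Q) : Prop :=
  ∀ (x : c.V) (y : d.V), c.π x = d.π y →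
    ∃ h : OpenPartialHomeomorph c.V d.V, x ∈ h.source ∧ h x = y ∧
      ContMDiffOn (𝓡 n) (𝓡 n) ∞ h h.source ∧ ContMDiffOn (𝓡 n) (𝓡 n) ∞ h.symm h.target ∧
      ∀ z ∈ h.source, d.π (h z) = c.π z

/-- An open embedding `(W, H, χ) → (V, G, π)` of orbifold charts: a diffeomorphism of `W` onto an
open subset of `V` which commutes with the projections to `Q`. -/
def OrbChart.IsEmbedding (d c : OrbChart n Q) (e : d.V → c.V) : Prop :=
  Topology.IsOpenEmbedding e ∧ IsLocalDiffeomorph (𝓡 n) (𝓡 n) ∞ e ∧ ∀ w, c.π (e w) = d.π w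

variable (n Q) in
/-- A reduced orbifold structure on `Q`: a maximal set of pairwise compatible orbifold charts
whose images cover `Q`. -/
structure OrbifoldStructure where
  charts : Set (OrbChart n Q)
  compatible : ∀ c ∈ charts, ∀ d ∈ charts, c.Compatible d
  cover : ∀ q : Q, ∃ c ∈ charts, q ∈ Set.range c.π
  maximal : ∀ c : OrbChart n Q, (∀ d ∈ charts, c.Compatible d) → c ∈ charts

/-- A representative of the orbifold structure `O`: an orbifold atlas, given as an indexed family
of charts of `O` that covers `Q`. -/
structure OrbAtlas (O : OrbifoldStructure n Q) where
  ι : Type u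
  chart : ι → OrbChart n Q
  chart_mem : ∀ i, chart i ∈ O.charts
  cover : ∀ q : Q, ∃ i, q ∈ Set.range (chart i).π

namespace OrbAtlas

variable {O : OrbifoldStructure n Q}

/-- The disjoint union `∐ᵢ Vᵢ` of the charts of an atlas. -/
abbrev Total (A : OrbAtlas O) : Type u := Σ i, (A.chart i).V

/-- The projection `∐ᵢ πᵢ : ∐ᵢ Vᵢ → Q`. -/
def proj (A : OrbAtlas O) (x : A.Total) : Q := (A.chart x.1).π x.2

/-- The pseudogroup `Ψ(𝒱)` of all transitions (diffeomorphisms between open subsets) of `∐ᵢ Vᵢ`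
which commute with the projection to `Q`. -/
def Psi (A : OrbAtlas O) : Set (OpenPartialHomeomorph A.Total A.Total) :=
  {f | ContMDiffOn (𝓡 n) (𝓡 n) ∞ f f.source ∧ ContMDiffOn (𝓡 n) (𝓡 n) ∞ f.symm f.target ∧
    ∀ x ∈ f.source, A.proj (f x) = A.proj x}

/-- A change of charts of the atlas: an element of `Ψ(𝒱)` from an open subset of one chart to an
open subset of one chart. -/
def IsChangeOfCharts (A : OrbAtlas O) (f : OpenPartialHomeomorph A.Total A.Total) : Prop :=
  f ∈ A.Psi ∧ (∃ i, f.source ⊆ Set.range (Sigma.mk i)) ∧ ∃ j, f.target ⊆ Set.range (Sigma.mk j)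

/-- An element of `Ψ(𝒱)` which is an open embedding between orbifold charts of the orbifold
structure: its domain is the underlying set of a chart `(W, H, χ)` of the structure, embedded as an
open subset of a chart of the atlas, and its values lie in one chart of the atlas. -/
def IsChartEmbedding (A : OrbAtlas O) (f : OpenPartialHomeomorph A.Total A.Total) : Prop :=
  f ∈ A.Psi ∧
    (∃ i, ∃ d ∈ O.charts, ∃ e : d.V → (A.chart i).V,
      d.IsEmbedding (A.chart i) e ∧ f.source = Sigma.mk i '' Set.range e) ∧
    ∃ j, f.target ⊆ Set.range (Sigma.mk j)

end OrbAtlas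

end Structures

/-! ### Quasi-pseudogroups

Equality of germs at `x` of maps defined near `x` is written `f =ᶠ[𝓝 x] g`. -/

/-- A set of transitions is a quasi-pseudogroup if, at the level of germs, it is closed under
inversion and composition. -/
def IsQuasiPseudogroup {M : Type*} [TopologicalSpace M]
    (P : Set (OpenPartialHomeomorph M M)) : Prop :=
  (∀ f ∈ P, ∀ x ∈ f.source, ∃ g ∈ P, f x ∈ g.source ∧ g =ᶠ[𝓝 (f x)] f.symm) ∧
  ∀ f ∈ P, ∀ g ∈ P, ∀ x ∈ f.source, f x ∈ g.source →
    ∃ h ∈ P, x ∈ h.source ∧ h =ᶠ[𝓝 x] g ∘ f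

/-- `P` generates `A`: it lies in `A`, and every element of `A` agrees near every point of its
domain with an element of `P`. (For `A` closed under restrictions and gluing, such as `Ψ(𝒱)`,
this determines `A` from `P`.) -/
def Generates {M : Type*} [TopologicalSpace M] (P A : Set (OpenPartialHomeomorph M M)) : Prop :=
  P ⊆ A ∧ ∀ f ∈ A, ∀ x ∈ f.source, ∃ g ∈ P, x ∈ g.source ∧ f =ᶠ[𝓝 x] g

/-! ### Charted orbifold maps -/

section Maps

variable {n n' n'' : ℕ} {Q Q' Q'' : Type u} [TopologicalSpace Q] [TopologicalSpace Q']
  [TopologicalSpace Q''] {O : OrbifoldStructure n Q} {O' : OrbifoldStructure n' Q'}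
  {O'' : OrbifoldStructure n'' Q''}

/-- A representative `(f, {f̃ᵢ}, P, ν)` of an orbifold map with domain atlas `A` and range family
contained in the atlas `B`. The `i`-th lift goes to the chart of `B` with index `idx i`, and
`∐ᵢ f̃ᵢ` is `Sigma.map idx lift`. Only the values of `ν` on `P` matter. -/
structure OrbMapRep (A : OrbAtlas O) (B : OrbAtlas O') where
  toFun : Q → Q'
  continuous_toFun : Continuous toFun
  idx : A.ι → B.ι
  lift : ∀ i, (A.chart i).V → (B.chart (idx i)).V
  smooth_lift : ∀ i, ContMDiff (𝓡 n) (𝓡 n') ∞ (lift i)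
  proj_lift : ∀ i x, (B.chart (idx i)).π (lift i x) = toFun ((A.chart i).π x)
  P : Set (OpenPartialHomeomorph A.Total A.Total)
  change_of_charts : ∀ f ∈ P, A.IsChangeOfCharts f
  quasi : IsQuasiPseudogroup P
  generates : Generates P A.Psi
  ν : OpenPartialHomeomorph A.Total A.Total → OpenPartialHomeomorph B.Total B.Total
  ν_embedding : ∀ f ∈ P, B.IsChartEmbedding (ν f)
  /-- `ψ ∘ f = ν(f) ∘ ψ` on the domain of `f`. -/
  ν_equivariant : ∀ f ∈ P, ∀ x ∈ f.source, Sigma.map idx lift x ∈ (ν f).source ∧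
    Sigma.map idx lift (f x) = ν f (Sigma.map idx lift x)
  ν_germ : ∀ f ∈ P, ∀ g ∈ P, ∀ x ∈ f.source ∩ g.source, f =ᶠ[𝓝 x] g →
    ν f =ᶠ[𝓝 (Sigma.map idx lift x)] ν g
  ν_mul : ∀ f ∈ P, ∀ g ∈ P, ∀ x ∈ f.source, f x ∈ g.source →
    ∀ h ∈ P, x ∈ h.source → h =ᶠ[𝓝 x] g ∘ f →
      ν h =ᶠ[𝓝 (Sigma.map idx lift x)] ν g ∘ ν f
  ν_unit : ∀ f ∈ P, ∀ x ∈ f.source, f =ᶠ[𝓝 x] id →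
    ν f =ᶠ[𝓝 (Sigma.map idx lift x)] id

namespace OrbMapRep

variable {A : OrbAtlas O} {B : OrbAtlas O'} {C : OrbAtlas O''}

/-- The map `ψ = ∐ᵢ f̃ᵢ` between the disjoint unions of the charts. -/
def total (r : OrbMapRep A B) : A.Total → B.Total := Sigma.map r.idx r.lift

theorem continuous_total (r : OrbMapRep A B) : Continuous r.total :=
  Continuous.sigma_map fun i => (r.smooth_lift i).continuous

/-- Equivalence of representatives with the same atlases: same map, same lifts, and `ν₁`, `ν₂`
assign the same germs to the same germs. -/
def Equiv (r s : OrbMapRep A B) : Prop :=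
  r.toFun = s.toFun ∧ r.total = s.total ∧
    ∀ f ∈ r.P, ∀ g ∈ s.P, ∀ x ∈ f.source ∩ g.source, f =ᶠ[𝓝 x] g →
      r.ν f =ᶠ[𝓝 (r.total x)] s.ν g

theorem equiv_equivalence : Equivalence (Equiv (A := A) (B := B)) where
  refl r := ⟨rfl, rfl, r.ν_germ⟩
  symm := by
    rintro r s ⟨h1, h2, h3⟩
    refine ⟨h1.symm, h2.symm, fun f hf g hg x hx hfg => ?_⟩
    rw [← h2]
    exact (h3 g hg f hf x hx.symm hfg.symm).symm
  trans := by
    rintro r s t ⟨h1, h2, h3⟩ ⟨k1, k2, k3⟩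
    refine ⟨h1.trans k1, h2.trans k2, fun f hf g hg x hx hfg => ?_⟩
    obtain ⟨m, hm, hxm, hfm⟩ := s.generates.2 f (r.generates.1 hf) x hx.1
    have e1 := h3 f hf m hm x ⟨hx.1, hxm⟩ hfm
    have e2 := k3 m hm g hg x ⟨hxm, hx.2⟩ (hfm.symm.trans hfg)
    rw [← h2] at e2
    exact e1.trans e2

instance setoid (A : OrbAtlas O) (B : OrbAtlas O') : Setoid (OrbMapRep A B) :=
  ⟨Equiv, equiv_equivalence⟩

/-! #### Composition of representatives -/

/-- `l` is a restriction of `μ`, and `ξ` has the same germs as `ν_f(μ)` along the image of the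
domain of `l`. -/
def Link (r : OrbMapRep A B) (s : OrbMapRep B C) (l μ : OpenPartialHomeomorph A.Total A.Total)
    (ξ : OpenPartialHomeomorph B.Total B.Total) : Prop :=
  μ ∈ r.P ∧ ξ ∈ s.P ∧ l.source ⊆ μ.source ∧ Set.EqOn l μ l.source ∧
    ∀ x ∈ l.source, r.total x ∈ ξ.source ∧ r.ν μ =ᶠ[𝓝 (r.total x)] ξ

theorem Link.germ {r : OrbMapRep A B} {s : OrbMapRep B C}
    {l μ : OpenPartialHomeomorph A.Total A.Total} {ξ : OpenPartialHomeomorph B.Total B.Total}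
    (h : Link r s l μ ξ) {x : A.Total} (hx : x ∈ l.source) : l =ᶠ[𝓝 x] μ := by
  filter_upwards [l.open_source.mem_nhds hx] with y hy using h.2.2.2.1 hy

/-- The transitions on which the composition is defined: those changes of charts that are
restrictions of elements `μ` of `P_f` to open sets along which `ν_f(μ)` agrees with an element
of `P_g`. -/
def compP (r : OrbMapRep A B) (s : OrbMapRep B C) :
    Set (OpenPartialHomeomorph A.Total A.Total) :=
  {l | A.IsChangeOfCharts l ∧ ∃ p : OpenPartialHomeomorph A.Total A.Total ×
    OpenPartialHomeomorph B.Total B.Total, Link r s l p.1 p.2}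

open Classical in
/-- The map `ν_h(μ|_U) = ν_g(ξ)`, where `ξ ∈ P_g` agrees with `ν_f(μ)`. -/
noncomputable def compν (r : OrbMapRep A B) (s : OrbMapRep B C)
    (l : OpenPartialHomeomorph A.Total A.Total) : OpenPartialHomeomorph C.Total C.Total :=
  if h : ∃ p : OpenPartialHomeomorph A.Total A.Total × OpenPartialHomeomorph B.Total B.Total,
    Link r s l p.1 p.2 then s.ν h.choose.2 else OpenPartialHomeomorph.refl _

theorem exists_link {r : OrbMapRep A B} {s : OrbMapRep B C}
    {l : OpenPartialHomeomorph A.Total A.Total} (h : l ∈ compP r s) :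
    ∃ μ ξ, Link r s l μ ξ ∧ compν r s l = s.ν ξ := by
  refine ⟨h.2.choose.1, h.2.choose.2, h.2.choose_spec, ?_⟩
  rw [compν, dif_pos h.2]

theorem exists_mem_compP (r : OrbMapRep A B) (s : OrbMapRep B C)
    {μ : OpenPartialHomeomorph A.Total A.Total} (hμ : μ ∈ r.P) {x : A.Total}
    (hx : x ∈ μ.source) : ∃ l ∈ compP r s, x ∈ l.source ∧ l =ᶠ[𝓝 x] μ := by
  obtain ⟨ξ, hξ, hxξ, hg⟩ := s.generates.2 (r.ν μ) (r.ν_embedding μ hμ).1 (r.total x)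
    (r.ν_equivariant μ hμ x hx).1
  set O₁ : Set B.Total := {y | r.ν μ =ᶠ[𝓝 y] ξ} ∩ ξ.source with hO₁
  have hO : IsOpen O₁ := isOpen_setOfPred_eventually_nhds.inter ξ.open_source
  have hU : IsOpen (r.total ⁻¹' O₁) := hO.preimage r.continuous_total
  obtain ⟨⟨p1, p2, p3⟩, ⟨i, hi⟩, j, hj⟩ := r.change_of_charts μ hμ
  refine ⟨μ.restrOpen _ hU, ⟨⟨⟨p1.mono ?_, p2.mono ?_, ?_⟩, ⟨i, ?_⟩, j, ?_⟩, (μ, ξ), hμ, hξ,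
    ?_, fun y _ => rfl, ?_⟩, ?_, ?_⟩
  · rw [OpenPartialHomeomorph.restrOpen_source]; exact Set.inter_subset_left
  · exact fun y hy => hy.1
  · intro y hy
    rw [OpenPartialHomeomorph.restrOpen_source] at hy
    exact p3 y hy.1
  · rw [OpenPartialHomeomorph.restrOpen_source]; exact Set.inter_subset_left.trans hi
  · exact fun y hy => hj hy.1
  · rw [OpenPartialHomeomorph.restrOpen_source]; exact Set.inter_subset_left
  · intro y hy
    rw [OpenPartialHomeomorph.restrOpen_source] at hy
    exact ⟨hy.2.2, hy.2.1⟩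
  · rw [OpenPartialHomeomorph.restrOpen_source]; exact ⟨hx, hg, hxξ⟩
  · exact Filter.Eventually.of_forall fun y => rfl

/-- The composition of representatives of orbifold maps: the maps and the lifts are composed, and
`(P_h, ν_h)` is obtained from `ν_g ∘ ν_f` after shrinking domains. -/
noncomputable def comp (s : OrbMapRep B C) (r : OrbMapRep A B) : OrbMapRep A C where
  toFun := s.toFun ∘ r.toFun
  continuous_toFun := s.continuous_toFun.comp r.continuous_toFun
  idx := s.idx ∘ r.idx
  lift i := s.lift (r.idx i) ∘ r.lift i
  smooth_lift i := (s.smooth_lift (r.idx i)).comp (r.smooth_lift i)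
  proj_lift i x := (s.proj_lift (r.idx i) (r.lift i x)).trans
    (congrArg s.toFun (r.proj_lift i x))
  P := compP r s
  change_of_charts f hf := hf.1
  quasi := by
    refine ⟨fun f hf x hx => ?_, fun f hf g hg x hx hgx => ?_⟩
    · obtain ⟨μ, ξ, L, -⟩ := exists_link hf
      have hxμ := L.2.2.1 hx
      have hval : f x = μ x := L.2.2.2.1 hx
      obtain ⟨μ', hμ', hx', he⟩ := r.quasi.1 μ L.1 x hxμ
      obtain ⟨g, hg, hgx, hgμ⟩ := exists_mem_compP r s hμ' hx'
      refine ⟨g, hg, hval ▸ hgx, ?_⟩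
      rw [hval]
      have h1 : f.symm =ᶠ[𝓝 (f x)] μ.symm := by
        filter_upwards [f.open_target.mem_nhds (f.map_source hx)] with y hy
        have hs := f.map_target hy
        have h2 : μ (f.symm y) = y := (L.2.2.2.1 hs).symm.trans (f.right_inv hy)
        calc f.symm y = μ.symm (μ (f.symm y)) := (μ.left_inv (L.2.2.1 hs)).symm
          _ = μ.symm y := by rw [h2]
      rw [hval] at h1
      exact hgμ.trans (he.trans h1.symm)
    · obtain ⟨μ, ξ, L, -⟩ := exists_link hf
      obtain ⟨μ', ξ', L', -⟩ := exists_link hg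
      have hval : f x = μ x := L.2.2.2.1 hx
      have hx' : μ x ∈ μ'.source := hval ▸ L'.2.2.1 hgx
      obtain ⟨m, hm, hxm, he⟩ := r.quasi.2 μ L.1 μ' L'.1 x (L.2.2.1 hx) hx'
      obtain ⟨h, hh, hxh, hhm⟩ := exists_mem_compP r s hm hxm
      refine ⟨h, hh, hxh, hhm.trans (he.trans ?_)⟩
      have ht : Filter.Tendsto f (𝓝 x) (𝓝 (f x)) := f.continuousAt hx
      filter_upwards [L.germ hx, ht.eventually (L'.germ hgx)] with y h1 h2
      simp only [Function.comp_apply] at h2 ⊢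
      rw [h2, h1]
  generates := by
    refine ⟨fun f hf => hf.1.1, fun f hf x hx => ?_⟩
    obtain ⟨μ, hμ, hxμ, he⟩ := r.generates.2 f hf x hx
    obtain ⟨g, hg, hxg, hgμ⟩ := exists_mem_compP r s hμ hxμ
    exact ⟨g, hg, hxg, he.trans hgμ.symm⟩
  ν := compν r s
  ν_embedding f hf := by
    obtain ⟨μ, ξ, L, e⟩ := exists_link hf
    rw [e]
    exact s.ν_embedding ξ L.2.1
  ν_equivariant f hf x hx := by
    obtain ⟨μ, ξ, L, e⟩ := exists_link hf
    rw [e]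
    obtain ⟨h1, h2⟩ := L.2.2.2.2 x hx
    obtain ⟨k1, k2⟩ := s.ν_equivariant ξ L.2.1 _ h1
    refine ⟨k1, ?_⟩
    have h3 : r.total (f x) = ξ (r.total x) := by
      rw [L.2.2.2.1 hx, ← h2.eq_of_nhds]
      exact (r.ν_equivariant μ L.1 x (L.2.2.1 hx)).2
    calc s.total (r.total (f x)) = s.total (ξ (r.total x)) := by rw [h3]
      _ = _ := k2
  ν_germ f hf g hg x hx hfg := by
    obtain ⟨μ, ξ, L, e⟩ := exists_link hf
    obtain ⟨μ', ξ', L', e'⟩ := exists_link hg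
    rw [e, e']
    have h1 : μ =ᶠ[𝓝 x] μ' := (L.germ hx.1).symm.trans (hfg.trans (L'.germ hx.2))
    have h2 := r.ν_germ μ L.1 μ' L'.1 x ⟨L.2.2.1 hx.1, L'.2.2.1 hx.2⟩ h1
    obtain ⟨a1, a2⟩ := L.2.2.2.2 x hx.1
    obtain ⟨b1, b2⟩ := L'.2.2.2.2 x hx.2
    exact s.ν_germ ξ L.2.1 ξ' L'.2.1 (r.total x) ⟨a1, b1⟩ (a2.symm.trans (h2.trans b2))
  ν_mul f hf g hg x hx hgx h hh hxh he := by
    obtain ⟨μ, ξ, L, e⟩ := exists_link hf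
    obtain ⟨μ', ξ', L', e'⟩ := exists_link hg
    obtain ⟨m, ζ, M, e''⟩ := exists_link hh
    rw [e, e', e'']
    have hval : f x = μ x := L.2.2.2.1 hx
    have hμ' : μ x ∈ μ'.source := hval ▸ L'.2.2.1 hgx
    have ht : Filter.Tendsto f (𝓝 x) (𝓝 (f x)) := f.continuousAt hx
    have h1 : m =ᶠ[𝓝 x] μ' ∘ μ := by
      filter_upwards [M.germ hxh, he, L.germ hx, ht.eventually (L'.germ hgx)] with y h1 h2 h3 h4
      simp only [Function.comp_apply] at h2 ⊢
      rw [← h1, h2, h4, h3]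
    have h2 := r.ν_mul μ L.1 μ' L'.1 x (L.2.2.1 hx) hμ' m M.1 (M.2.2.1 hxh) h1
    obtain ⟨a1, a2⟩ := L.2.2.2.2 x hx
    obtain ⟨b1, b2⟩ := L'.2.2.2.2 (f x) hgx
    obtain ⟨c1, c2⟩ := M.2.2.2.2 x hxh
    have hξ : ξ (r.total x) = r.total (f x) := by
      rw [hval, ← a2.eq_of_nhds]
      exact (r.ν_equivariant μ L.1 x (L.2.2.1 hx)).2.symm
    have ht' : Filter.Tendsto ξ (𝓝 (r.total x)) (𝓝 (r.total (f x))) :=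
      hξ ▸ ξ.continuousAt a1
    refine s.ν_mul ξ L.2.1 ξ' L'.2.1 (r.total x) a1 (hξ ▸ b1) ζ M.2.1 c1 ?_
    have h2' : r.ν m =ᶠ[𝓝 (r.total x)] r.ν μ' ∘ r.ν μ := h2
    filter_upwards [c2, h2', a2, ht'.eventually b2] with y h3 h4 h5 h6
    simp only [Function.comp_apply] at h4 ⊢
    rw [← h3, h4, h5, h6]
  ν_unit f hf x hx he := by
    obtain ⟨μ, ξ, L, e⟩ := exists_link hf
    rw [e]
    obtain ⟨a1, a2⟩ := L.2.2.2.2 x hx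
    have h1 := r.ν_unit μ L.1 x (L.2.2.1 hx) ((L.germ hx).symm.trans he)
    exact s.ν_unit ξ L.2.1 (r.total x) a1 (a2.symm.trans h1)

theorem comp_equiv {s s' : OrbMapRep B C} (hs : s ≈ s') {r r' : OrbMapRep A B} (hr : r ≈ r') :
    comp s r ≈ comp s' r' := by
  obtain ⟨h1, h2, h3⟩ := hs
  obtain ⟨k1, k2, k3⟩ := hr
  have ht : (comp s r).total = (comp s' r').total :=
    show s.total ∘ r.total = s'.total ∘ r'.total by rw [h2, k2]
  refine ⟨show s.toFun ∘ r.toFun = s'.toFun ∘ r'.toFun by rw [h1, k1], ht,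
    fun f hf g hg x hx hfg => ?_⟩
  obtain ⟨μ, ξ, L, e⟩ := exists_link hf
  obtain ⟨μ', ξ', L', e'⟩ := exists_link hg
  change compν r s f =ᶠ[𝓝 (s.total (r.total x))] compν r' s' g
  rw [e, e']
  have q1 : μ =ᶠ[𝓝 x] μ' := (L.germ hx.1).symm.trans (hfg.trans (L'.germ hx.2))
  have q2 := k3 μ L.1 μ' L'.1 x ⟨L.2.2.1 hx.1, L'.2.2.1 hx.2⟩ q1
  obtain ⟨a1, a2⟩ := L.2.2.2.2 x hx.1
  obtain ⟨b1, b2⟩ := L'.2.2.2.2 x hx.2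
  rw [← k2] at b1 b2
  exact h3 ξ L.2.1 ξ' L'.2.1 (r.total x) ⟨a1, b1⟩ (a2.symm.trans (q2.trans b2))

end OrbMapRep

/-- `Orb(𝒱, 𝒱')`: the charted orbifold maps with domain atlas `A` and range atlas `B`, i.e. the
equivalence classes of representatives. -/
def ChartedMap (A : OrbAtlas O) (B : OrbAtlas O') : Type u := Quotient (OrbMapRep.setoid A B)

/-- The composition of charted orbifold maps. -/
noncomputable def ChartedMap.comp {A : OrbAtlas O} {B : OrbAtlas O'} {C : OrbAtlas O''}
    (g : ChartedMap B C) (f : ChartedMap A B) : ChartedMap A C :=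
  Quotient.map₂ OrbMapRep.comp (fun _ _ hs _ _ hr => OrbMapRep.comp_equiv hs hr) g f

/-- A lift of the identity of the orbifold: a charted orbifold map whose underlying map is the
identity and whose local lifts are local diffeomorphisms. -/
def ChartedMap.IsLiftOfId {A B : OrbAtlas O} (ε : ChartedMap A B) : Prop :=
  ∃ r : OrbMapRep A B, Quotient.mk _ r = ε ∧ r.toFun = id ∧
    ∀ i, IsLocalDiffeomorph (𝓡 n) (𝓡 n) ∞ (r.lift i)

/-! ### Orbifold maps -/

variable (O O') in
/-- A charted orbifold map between some representatives of the two orbifold structures. -/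
structure AnyChartedMap where
  dom : OrbAtlas O
  ran : OrbAtlas O'
  map : ChartedMap dom ran

/-- Equivalence of charted orbifold maps: both induce, through lifts of the identities, one
charted orbifold map between common refinements of the atlases. -/
def AnyChartedMap.Sim (f₁ f₂ : AnyChartedMap O O') : Prop :=
  ∃ (W : OrbAtlas O) (W' : OrbAtlas O')
    (ε₁ : ChartedMap W f₁.dom) (ε₂ : ChartedMap W f₂.dom)
    (ε₁' : ChartedMap W' f₁.ran) (ε₂' : ChartedMap W' f₂.ran) (h : ChartedMap W W'),
    ε₁.IsLiftOfId ∧ ε₂.IsLiftOfId ∧ ε₁'.IsLiftOfId ∧ ε₂'.IsLiftOfId ∧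
    f₁.map.comp ε₁ = ε₁'.comp h ∧ f₂.map.comp ε₂ = ε₂'.comp h

/-- The class `[f̂]` of a charted orbifold map. -/
def AnyChartedMap.cls (f : AnyChartedMap O O') : Set (AnyChartedMap O O') := {g | f.Sim g}

variable (O O') in
/-- The morphisms of the category of reduced orbifolds (orbifold maps): the equivalence classes of
charted orbifold maps. -/
def OrbMorph : Type (u + 1) :=
  {F : Set (AnyChartedMap O O') // ∃ f : AnyChartedMap O O', F = f.cls}

/-- The orbifold map represented by a charted orbifold map. -/
def AnyChartedMap.toMorph (f : AnyChartedMap O O') : OrbMorph O O' := ⟨f.cls, f, rfl⟩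

/-- The choices made in composing orbifold maps: representatives `K`, `K'`, `K''` of the orbifold
structures, lifts of the identities, and charted maps `h`, `k` induced by `f`, `g`, such that

`f ∘ ε = ε₁' ∘ h` and `g ∘ ε₂' = ε'' ∘ k`. -/
structure CompChoice (f : AnyChartedMap O O') (g : AnyChartedMap O' O'') where
  K : OrbAtlas O
  K' : OrbAtlas O'
  K'' : OrbAtlas O''
  ε : ChartedMap K f.dom
  ε₁' : ChartedMap K' f.ran
  ε₂' : ChartedMap K' g.dom
  ε'' : ChartedMap K'' g.ran
  h : ChartedMap K K'
  k : ChartedMap K' K''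
  isLift_ε : ε.IsLiftOfId
  isLift_ε₁' : ε₁'.IsLiftOfId
  isLift_ε₂' : ε₂'.IsLiftOfId
  isLift_ε'' : ε''.IsLiftOfId
  comm_f : f.map.comp ε = ε₁'.comp h
  comm_g : g.map.comp ε₂' = ε''.comp k

/-- The composed charted orbifold map `k ∘ h : K → K''`. -/
noncomputable def CompChoice.result {f : AnyChartedMap O O'} {g : AnyChartedMap O' O''}
    (D : CompChoice f g) : AnyChartedMap O O'' := ⟨D.K, D.K'', D.k.comp D.h⟩

end Maps

end RedOrb

namespace RedOrb

/-! ### Smooth maps and disjoint unions -/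

section SigmaSmooth

variable {𝕜 : Type*} [NontriviallyNormedField 𝕜] {E : Type*} [NormedAddCommGroup E]
  [NormedSpace 𝕜 E] {H : Type*} [TopologicalSpace H] [Nonempty H] {I : ModelWithCorners 𝕜 E H}
  {E' : Type*} [NormedAddCommGroup E'] [NormedSpace 𝕜 E'] {H' : Type*} [TopologicalSpace H']
  {J : ModelWithCorners 𝕜 E' H'} {ι : Type*} {M : ι → Type*} [∀ i, TopologicalSpace (M i)]
  [∀ i, ChartedSpace H (M i)] {N : Type*} [TopologicalSpace N] [ChartedSpace H' N]
  {k : WithTop ℕ∞}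

/-! A charted orbifold map is a functor between groupoids of germs. The objects are the points of
the disjoint union of the charts, the arrows are germs of transitions, and the germs of `ν` are the
values on arrows. `GMap` keeps only these data; by `toGMap_eq_iff` the remaining choices in a
representative do not matter, and by `exists_toGMap_eq` every `GMap` whose map on points is smooth
comes from a charted map.

Two charted maps over different atlases are compared by an `IsCell`. It assigns germs of transitions
between the two range atlases to germs of transitions between the two domain atlases, compatibly
with the two functors on either side. It plays the role of a natural isomorphism and needs no common
refinement. Cells have inverses (`IsCell.symm`), vertical composites (`IsCell.trans`) and horizontal
composites (`IsCell.comp`).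

The main point is `sim_iff_iso`: the relation `Sim` is the same as the existence of a cell. In one
direction, a lift of the identity has its germs forced by its local diffeomorphisms (`eq_ofEtale`),
so an equation `f ∘ ε = ε' ∘ h` yields a cell from `h` to `f` (`exists_isCell_of_comp_eq`). In the
other, one chooses a germ of the cell at each point and refines the atlases by charts so small that
the chosen transitions are defined on whole charts. There they assemble to lifts of the identity
(`ChartedMap.exists_refinement`, `IsCell.comp_eq`). Small charts come from neighbourhoods stable
under isotropy (`exists_isStable`).

Consequently `Sim` is an equivalence relation, and independence of the choices is horizontal
composition of cells: the pairs `h` and `k` of any two choices are linked by cells, hence so are the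
composites (`CompChoice.result_iso`). Existence of choices is another use of the refinement lemma,
and it also gives uniqueness. -/

theorem chartAt_sigma_comp_mk (i : ι) (x : M i) :
    chartAt H (⟨i, x⟩ : Σ i, M i) ∘ Sigma.mk i = chartAt H x := by
  funext y
  exact OpenPartialHomeomorph.lift_openEmbedding_apply _ _

theorem contMDiff_sigmaMk (i : ι) : ContMDiff I I k (Sigma.mk i : M i → Σ i, M i) := by
  intro x
  have h := contMDiffAt_id (I := I) (n := k) (x := x)
  rw [contMDiffAt_iff] at h ⊢
  refine ⟨continuous_sigmaMk.continuousAt, ?_⟩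
  convert h.2 using 1
  funext y
  exact congrArg I (congrFun (chartAt_sigma_comp_mk i x) _)

/-- The preferred chart of the union at a point, restricted to its piece, is the preferred chart of
the piece, so both sides have the same expression in coordinates. -/
theorem contMDiffAt_sigma_iff {f : (Σ i, M i) → N} {i : ι} {x : M i} :
    ContMDiffAt I J k f ⟨i, x⟩ ↔ ContMDiffAt I J k (f ∘ Sigma.mk i) x := by
  refine ⟨fun h => h.comp x (contMDiff_sigmaMk i x), fun h => ?_⟩
  rw [contMDiffAt_iff] at h ⊢
  refine ⟨?_, ?_⟩
  · exact (Topology.IsOpenEmbedding.sigmaMk.continuousAt_iff (f := Sigma.mk i)).1 h.1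
  · have e : extChartAt I (⟨i, x⟩ : Σ i, M i) ⟨i, x⟩ = extChartAt I x x :=
      congrArg I (congrFun (chartAt_sigma_comp_mk i x) x)
    rw [e]
    exact h.2

end SigmaSmooth

/-! ### Transitions between two atlases of one orbifold -/

section Structures

variable {n : ℕ} {Q : Type u} [TopologicalSpace Q] {O : OrbifoldStructure n Q}

/-- The inclusion of a chart into the disjoint union of the charts. -/
noncomputable def OrbAtlas.incl (A : OrbAtlas O) (i : A.ι) :
    OpenPartialHomeomorph (A.chart i).V A.Total :=
  (Topology.IsOpenEmbedding.sigmaMk (σ := fun i => (A.chart i).V) (i := i)).toOpenPartialHomeomorph _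

@[simp] theorem OrbAtlas.mk_mem_incl_target (A : OrbAtlas O) (i : A.ι) (x : (A.chart i).V) :
    (⟨i, x⟩ : A.Total) ∈ (A.incl i).target := (A.incl i).map_source (Set.mem_univ x)

@[simp] theorem OrbAtlas.incl_symm_mk (A : OrbAtlas O) (i : A.ι) (x : (A.chart i).V) :
    (A.incl i).symm ⟨i, x⟩ = x := (A.incl i).left_inv (Set.mem_univ x)

theorem OrbAtlas.contMDiffOn_incl (A : OrbAtlas O) (i : A.ι) :
    ContMDiffOn (𝓡 n) (𝓡 n) ∞ (A.incl i) (A.incl i).source :=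
  (contMDiff_sigmaMk i).contMDiffOn

theorem OrbAtlas.contMDiffOn_incl_symm (A : OrbAtlas O) (i : A.ι) :
    ContMDiffOn (𝓡 n) (𝓡 n) ∞ (A.incl i).symm (A.incl i).target := by
  intro x hx
  refine ContMDiffAt.contMDiffWithinAt ?_
  rw [← (A.incl i).right_inv hx]
  refine contMDiffAt_sigma_iff.2 ?_
  refine contMDiffAt_id.congr_of_eventuallyEq (Filter.Eventually.of_forall fun y => ?_)
  exact A.incl_symm_mk i y

theorem OrbAtlas.exists_proj_eq (A : OrbAtlas O) (q : Q) : ∃ x : A.Total, A.proj x = q := by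
  obtain ⟨i, x, hx⟩ := A.cover q
  exact ⟨⟨i, x⟩, hx⟩

variable {A B C : OrbAtlas O}

variable (A B) in
/-- The transitions between the disjoint unions of the charts of two atlases of an orbifold:
diffeomorphisms between open subsets that commute with the projections. -/
structure Trn : Type u where
  toOPH : OpenPartialHomeomorph A.Total B.Total
  smooth : ContMDiffOn (𝓡 n) (𝓡 n) ∞ toOPH toOPH.source
  smooth_symm : ContMDiffOn (𝓡 n) (𝓡 n) ∞ toOPH.symm toOPH.target
  proj : ∀ x ∈ toOPH.source, B.proj (toOPH x) = A.proj x

namespace Trn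

instance : CoeFun (Trn A B) fun _ => A.Total → B.Total := ⟨fun φ => φ.toOPH⟩

/-- The domain of a transition. -/
def src (φ : Trn A B) : Set A.Total := φ.toOPH.source

theorem isOpen_src (φ : Trn A B) : IsOpen φ.src := φ.toOPH.open_source

theorem src_mem_nhds (φ : Trn A B) {x : A.Total} (hx : x ∈ φ.src) : φ.src ∈ 𝓝 x :=
  φ.isOpen_src.mem_nhds hx

theorem proj_apply (φ : Trn A B) {x : A.Total} (hx : x ∈ φ.src) : B.proj (φ x) = A.proj x :=
  φ.proj x hx

theorem continuousAt (φ : Trn A B) {x : A.Total} (hx : x ∈ φ.src) : ContinuousAt φ x :=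
  φ.toOPH.continuousAt hx

theorem contMDiffAt (φ : Trn A B) {x : A.Total} (hx : x ∈ φ.src) :
    ContMDiffAt (𝓡 n) (𝓡 n) ∞ φ x :=
  (φ.smooth x hx).contMDiffAt (φ.src_mem_nhds hx)

theorem injOn (φ : Trn A B) : Set.InjOn φ φ.src := φ.toOPH.injOn

variable (A) in
/-- The identity transition. -/
def refl : Trn A A :=
  ⟨OpenPartialHomeomorph.refl _, contMDiff_id.contMDiffOn, contMDiff_id.contMDiffOn,
    fun _ _ => rfl⟩

@[simp] theorem mem_refl_src (x : A.Total) : x ∈ (refl A).src := Set.mem_univ x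

/-- The inverse transition. -/
def symm (φ : Trn A B) : Trn B A :=
  ⟨φ.toOPH.symm, φ.smooth_symm, φ.smooth, fun y hy => by
    have h := φ.proj _ (φ.toOPH.map_target hy)
    rw [φ.toOPH.right_inv hy] at h
    exact h.symm⟩

theorem apply_mem_symm_src (φ : Trn A B) {x : A.Total} (hx : x ∈ φ.src) : φ x ∈ φ.symm.src :=
  φ.toOPH.map_source hx

theorem symm_apply_mem_src (φ : Trn A B) {y : B.Total} (hy : y ∈ φ.symm.src) :
    φ.symm y ∈ φ.src :=
  φ.toOPH.map_target hy

theorem symm_apply_apply (φ : Trn A B) {x : A.Total} (hx : x ∈ φ.src) : φ.symm (φ x) = x :=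
  φ.toOPH.left_inv hx

theorem apply_symm_apply (φ : Trn A B) {y : B.Total} (hy : y ∈ φ.symm.src) :
    φ (φ.symm y) = y :=
  φ.toOPH.right_inv hy

/-- The composition of transitions, `φ` first. -/
def trans (φ : Trn A B) (χ : Trn B C) : Trn A C :=
  ⟨φ.toOPH.trans χ.toOPH,
    χ.smooth.comp (φ.smooth.mono fun x hx => by
      rw [OpenPartialHomeomorph.trans_source] at hx; exact hx.1) fun x hx => by
      rw [OpenPartialHomeomorph.trans_source] at hx; exact hx.2,
    φ.smooth_symm.comp (χ.smooth_symm.mono fun x hx => by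
      rw [OpenPartialHomeomorph.trans_target] at hx; exact hx.1) fun x hx => by
      rw [OpenPartialHomeomorph.trans_target] at hx; exact hx.2,
    fun x hx => by
      rw [OpenPartialHomeomorph.trans_source] at hx
      exact (χ.proj _ hx.2).trans (φ.proj _ hx.1)⟩

@[simp] theorem trans_apply (φ : Trn A B) (χ : Trn B C) (x : A.Total) :
    φ.trans χ x = χ (φ x) := rfl

theorem mem_trans_src {φ : Trn A B} {χ : Trn B C} {x : A.Total} (hx : x ∈ φ.src)
    (hx' : φ x ∈ χ.src) : x ∈ (φ.trans χ).src := by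
  change x ∈ (φ.toOPH.trans χ.toOPH).source
  rw [OpenPartialHomeomorph.trans_source]
  exact ⟨hx, hx'⟩

/-- The restriction of a transition to an open set. -/
noncomputable def restr (φ : Trn A B) (U : Set A.Total) (hU : IsOpen U) : Trn A B :=
  ⟨φ.toOPH.restrOpen U hU, φ.smooth.mono fun x hx => by
      rw [OpenPartialHomeomorph.restrOpen_source] at hx; exact hx.1,
    φ.smooth_symm.mono fun x hx => hx.1, fun x hx => by
      rw [OpenPartialHomeomorph.restrOpen_source] at hx; exact φ.proj x hx.1⟩

@[simp] theorem restr_apply (φ : Trn A B) (U : Set A.Total) (hU : IsOpen U) (x : A.Total) :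
    φ.restr U hU x = φ x := rfl

theorem restr_src (φ : Trn A B) (U : Set A.Total) (hU : IsOpen U) :
    (φ.restr U hU).src = φ.src ∩ U :=
  OpenPartialHomeomorph.restrOpen_source _ _ hU

/-- A transition between two charts, as a transition between atlases. -/
noncomputable def ofCharts (i : A.ι) (j : B.ι)
    (e : OpenPartialHomeomorph (A.chart i).V (B.chart j).V)
    (s1 : ContMDiffOn (𝓡 n) (𝓡 n) ∞ e e.source)
    (s2 : ContMDiffOn (𝓡 n) (𝓡 n) ∞ e.symm e.target)
    (hp : ∀ z ∈ e.source, (B.chart j).π (e z) = (A.chart i).π z) : Trn A B where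
  toOPH := (A.incl i).symm.trans (e.trans (B.incl j))
  smooth := by
    refine ((B.contMDiffOn_incl j).comp s1 (fun _ _ => Set.mem_univ _)).comp
      ((A.contMDiffOn_incl_symm i).mono ?_) ?_
    · intro z hz; rw [OpenPartialHomeomorph.trans_source] at hz; exact hz.1
    · intro z hz
      rw [OpenPartialHomeomorph.trans_source] at hz
      have := hz.2
      simp only [Set.mem_preimage, OpenPartialHomeomorph.trans_source] at this
      exact this.1
  smooth_symm := by
    refine ((A.contMDiffOn_incl i).comp s2 (fun _ _ => Set.mem_univ _)).comp
      ((B.contMDiffOn_incl_symm j).mono ?_) ?_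
    · rintro z ⟨⟨hz, -⟩, -⟩; exact hz
    · rintro z ⟨⟨-, hz⟩, -⟩; exact hz
  proj := by
    rintro z ⟨hz, hz', -⟩
    obtain ⟨w, -, rfl⟩ : ∃ w, w ∈ (Set.univ : Set (A.chart i).V) ∧ A.incl i w = z :=
      ⟨(A.incl i).symm z, trivial, (A.incl i).right_inv hz⟩
    have hw : w ∈ e.source := by
      have := hz'
      change (A.incl i).symm ⟨i, w⟩ ∈ e.source at this
      rwa [A.incl_symm_mk] at this
    have := hp w hw
    change (B.chart j).π (e ((A.incl i).symm ⟨i, w⟩)) = (A.chart i).π w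
    rwa [A.incl_symm_mk]

section ofCharts

variable {i : A.ι} {j : B.ι} {e : OpenPartialHomeomorph (A.chart i).V (B.chart j).V}
  {s1 : ContMDiffOn (𝓡 n) (𝓡 n) ∞ e e.source} {s2 : ContMDiffOn (𝓡 n) (𝓡 n) ∞ e.symm e.target}
  {hp : ∀ z ∈ e.source, (B.chart j).π (e z) = (A.chart i).π z}

theorem ofCharts_apply (x : (A.chart i).V) :
    ofCharts i j e s1 s2 hp ⟨i, x⟩ = ⟨j, e x⟩ := by
  change (⟨j, e ((A.incl i).symm ⟨i, x⟩)⟩ : B.Total) = ⟨j, e x⟩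
  rw [A.incl_symm_mk]

theorem mem_ofCharts_src {x : (A.chart i).V} (hx : x ∈ e.source) :
    (⟨i, x⟩ : A.Total) ∈ (ofCharts i j e s1 s2 hp).src := by
  refine ⟨A.mk_mem_incl_target i x, ?_, trivial⟩
  change (A.incl i).symm ⟨i, x⟩ ∈ e.source
  rwa [A.incl_symm_mk]

theorem exists_of_mem_ofCharts_src {y : A.Total} (hy : y ∈ (ofCharts i j e s1 s2 hp).src) :
    ∃ x ∈ e.source, y = ⟨i, x⟩ := by
  obtain ⟨hz, hz', -⟩ := hy
  exact ⟨(A.incl i).symm y, hz', ((A.incl i).right_inv hz).symm⟩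

end ofCharts

/-- Points over the same point of the orbifold are matched by a transition. -/
theorem exists_of_proj_eq (x : A.Total) (y : B.Total) (h : A.proj x = B.proj y) :
    ∃ φ : Trn A B, x ∈ φ.src ∧ φ x = y := by
  obtain ⟨i, x⟩ := x
  obtain ⟨j, y⟩ := y
  obtain ⟨e, hx, hy, s1, s2, hp⟩ := O.compatible _ (A.chart_mem i) _ (B.chart_mem j) x y h
  exact ⟨ofCharts i j e s1 s2 hp, mem_ofCharts_src hx, by rw [ofCharts_apply, hy]⟩

end Trn

end Structures

section Structures

variable {n : ℕ} {Q : Type u} [TopologicalSpace Q] {O : OrbifoldStructure n Q}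
  {A B C : OrbAtlas O}

/-! ### Germs of transitions -/

namespace Trn

theorem eventually_mem_src (φ : Trn A B) {x : A.Total} (hx : x ∈ φ.src) :
    ∀ᶠ y in 𝓝 x, y ∈ φ.src := φ.src_mem_nhds hx

theorem eventually_symm_apply_apply (φ : Trn A B) {x : A.Total} (hx : x ∈ φ.src) :
    ∀ᶠ y in 𝓝 x, φ.symm (φ y) = y :=
  (φ.eventually_mem_src hx).mono fun _ => φ.symm_apply_apply

theorem symm_continuousAt (φ : Trn A B) {x : A.Total} (hx : x ∈ φ.src) :
    Filter.Tendsto φ.symm (𝓝 (φ x)) (𝓝 x) := by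
  have h := φ.symm.continuousAt (φ.apply_mem_symm_src hx)
  rwa [ContinuousAt, φ.symm_apply_apply hx] at h

/-- Transitions are local homeomorphisms, so identities of germs can be pulled back and pushed
forward along them. Most germ computations below are transported this way. -/
theorem eventually_map (φ : Trn A B) {x : A.Total} (hx : x ∈ φ.src) {p : B.Total → Prop} :
    (∀ᶠ y in 𝓝 (φ x), p y) ↔ ∀ᶠ y in 𝓝 x, p (φ y) := by
  refine ⟨fun h => (φ.continuousAt hx).eventually h, fun h => ?_⟩
  filter_upwards [(φ.symm_continuousAt hx).eventually h,
    φ.symm.eventually_mem_src (φ.apply_mem_symm_src hx)] with y h1 h2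
  rwa [φ.apply_symm_apply h2] at h1

theorem symm_germ {φ φ' : Trn A B} {x : A.Total} (hx : x ∈ φ.src) (hx' : x ∈ φ'.src)
    (h : φ' =ᶠ[𝓝 x] φ) : φ'.symm =ᶠ[𝓝 (φ x)] φ.symm := by
  refine (φ.eventually_map hx).2 ?_
  filter_upwards [h, φ.eventually_mem_src hx, φ'.eventually_mem_src hx'] with y h1 h2 h3
  rw [φ.symm_apply_apply h2, ← h1, φ'.symm_apply_apply h3]

end Trn

end Structures

section Maps

variable {n n' n'' : ℕ} {Q Q' Q'' : Type u} [TopologicalSpace Q] [TopologicalSpace Q']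
  [TopologicalSpace Q''] {O : OrbifoldStructure n Q} {O' : OrbifoldStructure n' Q'}
  {O'' : OrbifoldStructure n'' Q''}

/-! ### Relations between germs of transitions -/

/-- A relation between germs of transitions of the atlases of two orbifolds. -/
abbrev GRel (A₁ A₂ : OrbAtlas O) (B₁ B₂ : OrbAtlas O') : Type u :=
  A₁.Total → Trn A₁ A₂ → Trn B₁ B₂ → Prop

/-- `T` relates every germ `x ↦ φ x` to a germ `ψ₁ x ↦ ψ₂ (φ x)`, locally constantly. -/
structure IsGermRel {A₁ A₂ : OrbAtlas O} {B₁ B₂ : OrbAtlas O'} (ψ₁ : A₁.Total → B₁.Total)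
    (ψ₂ : A₂.Total → B₂.Total) (T : GRel A₁ A₂ B₁ B₂) : Prop where
  mem : ∀ {x φ χ}, T x φ χ → x ∈ φ.src
  mem' : ∀ {x φ χ}, T x φ χ → ψ₁ x ∈ χ.src
  map_eq : ∀ {x φ χ}, T x φ χ → χ (ψ₁ x) = ψ₂ (φ x)
  exists_rel : ∀ {x} {φ : Trn A₁ A₂}, x ∈ φ.src → ∃ χ, T x φ χ
  congr : ∀ {x φ χ} {φ' : Trn A₁ A₂} {χ' : Trn B₁ B₂}, T x φ χ → x ∈ φ'.src → φ' =ᶠ[𝓝 x] φ → ψ₁ x ∈ χ'.src →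
    χ' =ᶠ[𝓝 (ψ₁ x)] χ → T x φ' χ'
  eventually : ∀ {x φ χ}, T x φ χ → ∀ᶠ y in 𝓝 x, T y φ χ

/-- Composites of germs related by `T₁₂` and `T₂₃` are related by `T₁₃`. -/
def Tri {A₁ A₂ A₃ : OrbAtlas O} {B₁ B₂ B₃ : OrbAtlas O'} (ψ : A₁.Total → B₁.Total)
    (T₁₂ : GRel A₁ A₂ B₁ B₂) (T₂₃ : GRel A₂ A₃ B₂ B₃) (T₁₃ : GRel A₁ A₃ B₁ B₃) : Prop :=
  ∀ ⦃x a α b β c γ⦄, T₁₂ x a α → T₂₃ (a x) b β → T₁₃ x c γ → (c =ᶠ[𝓝 x] fun y => b (a y)) →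
    γ =ᶠ[𝓝 (ψ x)] fun z => β (α z)

/-- The composition of relations between germs. -/
def GRel.comp {A₁ A₂ : OrbAtlas O} {B₁ B₂ : OrbAtlas O'} {C₁ C₂ : OrbAtlas O''}
    (S : GRel B₁ B₂ C₁ C₂) (ψ : A₁.Total → B₁.Total) (T : GRel A₁ A₂ B₁ B₂) : GRel A₁ A₂ C₁ C₂ :=
  fun x φ χ => ∃ ξ, T x φ ξ ∧ S (ψ x) ξ χ

theorem IsGermRel.comp {A₁ A₂ : OrbAtlas O} {B₁ B₂ : OrbAtlas O'} {C₁ C₂ : OrbAtlas O''}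
    {ψ₁ : A₁.Total → B₁.Total} {ψ₂ : A₂.Total → B₂.Total} {T : GRel A₁ A₂ B₁ B₂}
    {θ₁ : B₁.Total → C₁.Total} {θ₂ : B₂.Total → C₂.Total} {S : GRel B₁ B₂ C₁ C₂}
    (hS : IsGermRel θ₁ θ₂ S) (hψ : Continuous ψ₁) (hT : IsGermRel ψ₁ ψ₂ T) :
    IsGermRel (θ₁ ∘ ψ₁) (θ₂ ∘ ψ₂) (S.comp ψ₁ T) where
  mem := by rintro x φ χ ⟨ξ, h1, h2⟩; exact hT.mem h1
  mem' := by rintro x φ χ ⟨ξ, h1, h2⟩; exact hS.mem' h2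
  map_eq := by
    rintro x φ χ ⟨ξ, h1, h2⟩
    exact (hS.map_eq h2).trans (congrArg θ₂ (hT.map_eq h1))
  exists_rel := by
    intro x φ hx
    obtain ⟨ξ, h1⟩ := hT.exists_rel hx
    obtain ⟨χ, h2⟩ := hS.exists_rel (hT.mem' h1)
    exact ⟨χ, ξ, h1, h2⟩
  congr := by
    rintro x φ χ φ' χ' ⟨ξ, h1, h2⟩ hx hφ hx' hχ
    exact ⟨ξ, hT.congr h1 hx hφ (hT.mem' h1) (Filter.EventuallyEq.refl _ _),
      hS.congr h2 (hT.mem' h1) (Filter.EventuallyEq.refl _ _) hx' hχ⟩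
  eventually := by
    rintro x φ χ ⟨ξ, h1, h2⟩
    filter_upwards [hT.eventually h1, hψ.continuousAt.eventually (hS.eventually h2)] with y h3 h4
    exact ⟨ξ, h3, h4⟩

theorem Tri.comp {A₁ A₂ A₃ : OrbAtlas O} {B₁ B₂ B₃ : OrbAtlas O'} {C₁ C₂ C₃ : OrbAtlas O''}
    {ψ₁ : A₁.Total → B₁.Total} {ψ₂ : A₂.Total → B₂.Total} {θ : B₁.Total → C₁.Total}
    {T₁₂ : GRel A₁ A₂ B₁ B₂} {T₂₃ : GRel A₂ A₃ B₂ B₃} {T₁₃ : GRel A₁ A₃ B₁ B₃}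
    {S₁₂ : GRel B₁ B₂ C₁ C₂} {S₂₃ : GRel B₂ B₃ C₂ C₃} {S₁₃ : GRel B₁ B₃ C₁ C₃}
    (hS : Tri θ S₁₂ S₂₃ S₁₃) (hψ : IsGermRel ψ₁ ψ₂ T₁₂) (hT : Tri ψ₁ T₁₂ T₂₃ T₁₃) :
    Tri (θ ∘ ψ₁) (S₁₂.comp ψ₁ T₁₂) (S₂₃.comp ψ₂ T₂₃) (S₁₃.comp ψ₁ T₁₃) := by
  rintro x a α b β c γ ⟨ξ, h1, h2⟩ ⟨η, h3, h4⟩ ⟨ζ, h5, h6⟩ h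
  rw [← hψ.map_eq h1] at h4
  exact hS h2 h4 h6 (hT h1 h3 h5 h)

/-- The data determining a charted orbifold map: the continuous map, the map between the disjoint
unions of the charts, and the multiplicative assignment of germs of transitions. -/
@[ext]
structure GMap (A : OrbAtlas O) (B : OrbAtlas O') where
  toFun : Q → Q'
  tot : A.Total → B.Total
  rel : GRel A A B B
  continuous_toFun : Continuous toFun
  continuous_tot : Continuous tot
  proj_tot : ∀ x, B.proj (tot x) = toFun (A.proj x)
  isGermRel : IsGermRel tot tot rel
  tri : Tri tot rel rel rel

/-- A natural isomorphism between assignments of germs, over a common refinement of the atlases. -/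
structure IsCell {A₁ A₂ : OrbAtlas O} {B₁ B₂ : OrbAtlas O'} (f₁ : GMap A₁ B₁) (f₂ : GMap A₂ B₂)
    (T : GRel A₁ A₂ B₁ B₂) : Prop extends IsGermRel f₁.tot f₂.tot T where
  left : Tri f₁.tot f₁.rel T T
  right : Tri f₁.tot T f₂.rel T

namespace GMap

variable {A A₁ A₂ A₃ : OrbAtlas O} {B B₁ B₂ B₃ : OrbAtlas O'} {C C₁ C₂ C₃ : OrbAtlas O''}

/-- The identity cell. It makes general facts on cells, such as uniqueness of the assigned germ,
available for a single charted map. -/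
theorem isCell_rel (f : GMap A B) : IsCell f f f.rel where
  toIsGermRel := f.isGermRel
  left := f.tri
  right := f.tri

/-- Preservation of units need not be an axiom: multiplicativity makes `χ` idempotent near `f.tot
x`, and an injective idempotent is the identity. -/
theorem rel_unit (f : GMap A B) {x : A.Total} {φ : Trn A A} {χ : Trn B B} (h : f.rel x φ χ)
    (hφ : φ =ᶠ[𝓝 x] id) : χ =ᶠ[𝓝 (f.tot x)] id := by
  have hx : φ x = x := hφ.eq_of_nhds
  have hχ : χ (f.tot x) = f.tot x := (f.isGermRel.map_eq h).trans (congrArg _ hx)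
  have hm := f.isGermRel.mem' h
  have h' : f.rel (φ x) φ χ := by rw [hx]; exact h
  have := f.tri h h' h (by
    filter_upwards [hφ] with y hy
    simp only [id] at hy
    rw [hy, hy])
  have ht := χ.continuousAt hm
  rw [ContinuousAt, hχ] at ht
  filter_upwards [this, χ.eventually_mem_src hm, ht.eventually (χ.eventually_mem_src hm)]
    with z h1 h2 h3
  exact (χ.injOn h2 h3 h1).symm

end GMap

namespace IsCell

variable {A A₁ A₂ A₃ : OrbAtlas O} {B B₁ B₂ B₃ : OrbAtlas O'} {C C₁ C₂ C₃ : OrbAtlas O''}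
  {f₁ : GMap A₁ B₁} {f₂ : GMap A₂ B₂} {f₃ : GMap A₃ B₃} {T T₁₂ : GRel A₁ A₂ B₁ B₂}
  {T₂₃ : GRel A₂ A₃ B₂ B₃}

/-- Single-valuedness is not part of `IsGermRel`. It follows from compatibility on the left, applied
to the unit germ at `x`, whose assigned germ is again a unit. -/
theorem germ_unique (hT : IsCell f₁ f₂ T) {x : A₁.Total} {φ φ' : Trn A₁ A₂} {χ χ' : Trn B₁ B₂}
    (h : T x φ χ) (h' : T x φ' χ') (hφ : φ =ᶠ[𝓝 x] φ') : χ =ᶠ[𝓝 (f₁.tot x)] χ' := by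
  obtain ⟨u, hu⟩ := f₁.isGermRel.exists_rel (Trn.mem_refl_src x)
  have h1 := f₁.rel_unit hu (Filter.EventuallyEq.refl _ _)
  refine (hT.left hu h' h hφ).trans ?_
  filter_upwards [h1] with z hz
  rw [hz, id]

/-- A related germ carries `f₁.tot x` to `f₂.tot (φ x)`, and transitions preserve projections. -/
theorem toFun_eq (hT : IsCell f₁ f₂ T) : f₁.toFun = f₂.toFun := by
  funext q
  obtain ⟨x, rfl⟩ := A₁.exists_proj_eq q
  obtain ⟨y, hy⟩ := A₂.exists_proj_eq (A₁.proj x)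
  obtain ⟨φ, hx, hφ⟩ := Trn.exists_of_proj_eq x y hy.symm
  obtain ⟨χ, h⟩ := hT.exists_rel hx
  rw [← f₁.proj_tot, ← χ.proj_apply (hT.mem' h), hT.map_eq h, f₂.proj_tot, hφ, hy]

theorem symm (hT : IsCell f₁ f₂ T) :
    IsCell f₂ f₁ fun x φ χ => x ∈ φ.src ∧ T (φ x) φ.symm χ.symm := by
  have key : ∀ {x : A₂.Total} {φ : Trn A₂ A₁} {χ : Trn B₂ B₁}, x ∈ φ.src →
      T (φ x) φ.symm χ.symm → f₂.tot x ∈ χ.src ∧ χ (f₂.tot x) = f₁.tot (φ x) := by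
    intro x φ χ hx h
    have h1 := hT.map_eq h
    have h2 := hT.mem' h
    rw [φ.symm_apply_apply hx] at h1
    rw [← h1]
    exact ⟨χ.symm_apply_mem_src h2, χ.apply_symm_apply h2⟩
  have base : IsGermRel f₂.tot f₁.tot
      fun x (φ : Trn A₂ A₁) (χ : Trn B₂ B₁) => x ∈ φ.src ∧ T (φ x) φ.symm χ.symm := by
    refine ⟨fun h => h.1, fun h => (key h.1 h.2).1, fun h => (key h.1 h.2).2, ?_, ?_, ?_⟩
    · intro x φ hx
      obtain ⟨χ, h⟩ := hT.exists_rel (φ.apply_mem_symm_src hx)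
      exact ⟨χ.symm, hx, h⟩
    · rintro x φ χ φ' χ' ⟨hx, h⟩ hx' hφ hχ' hχ
      obtain ⟨k1, k2⟩ := key hx h
      refine ⟨hx', ?_⟩
      rw [hφ.eq_of_nhds]
      have e : φ' x = φ x := hφ.eq_of_nhds
      have e' : χ' (f₂.tot x) = χ (f₂.tot x) := hχ.eq_of_nhds
      refine hT.congr h (e ▸ φ'.apply_mem_symm_src hx') (Trn.symm_germ hx hx' hφ) ?_ ?_
      · rw [← k2, ← e']; exact χ'.apply_mem_symm_src hχ'
      · rw [← k2]; exact Trn.symm_germ k1 hχ' hχ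
    · rintro x φ χ ⟨hx, h⟩
      filter_upwards [φ.eventually_mem_src hx,
        (φ.continuousAt hx).eventually (hT.eventually h)] with y h1 h2 using ⟨h1, h2⟩
  refine ⟨base, ?_, ?_⟩
  -- Left compatibility of the inverse is right compatibility of `T`, with `c = b ∘ a` rewritten as
  -- `b⁻¹ = a ∘ c⁻¹`.
  · rintro x a α b β c γ ha ⟨hb, hb'⟩ ⟨hc, hc'⟩ h
    have hcx : c x = b (a x) := h.eq_of_nhds
    have hax := f₂.isGermRel.mem ha
    obtain ⟨k1, k2⟩ := key hc hc'
    have ha' : f₂.rel (c.symm (c x)) a α := by rwa [c.symm_apply_apply hc]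
    have hb'' : T (c x) b.symm β.symm := by rwa [hcx]
    have := hT.right hc' ha' hb'' (by
      refine (c.eventually_map hc).2 ?_
      filter_upwards [h, c.eventually_mem_src hc,
        (a.continuousAt hax).eventually (b.eventually_mem_src hb)] with y h1 h2 h3
      rw [c.symm_apply_apply h2, h1, b.symm_apply_apply h3])
    rw [← k2] at this
    have hm := hT.mem' hb''
    rw [← k2] at hm
    filter_upwards [(γ.eventually_map k1).1 this, γ.eventually_mem_src k1,
      (γ.continuousAt k1).eventually (β.symm.eventually_mem_src hm)] with z h1 h2 h3
    rw [γ.symm_apply_apply h2] at h1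
    rw [← h1, β.apply_symm_apply h3]
  -- Dually, left compatibility of `T` is applied to `a⁻¹ = c⁻¹ ∘ b`.
  · rintro x a α b β c γ ⟨ha, ha'⟩ hb ⟨hc, hc'⟩ h
    have hcx : c x = b (a x) := h.eq_of_nhds
    have hbx := f₁.isGermRel.mem hb
    obtain ⟨k1, k2⟩ := key ha ha'
    have hc'' : T (b (a x)) c.symm γ.symm := by rwa [← hcx]
    have hβ := f₁.isGermRel.map_eq hb
    have hβm := f₁.isGermRel.mem' hb
    have := hT.left hb hc'' ha' (by
      refine (a.eventually_map ha).2 ?_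
      filter_upwards [h, c.eventually_mem_src hc, a.eventually_mem_src ha] with y h1 h2 h3
      rw [a.symm_apply_apply h3, ← h1, c.symm_apply_apply h2])
    rw [← k2] at this hβ hβm
    have hm := hT.mem' hc''
    rw [← hβ] at hm
    filter_upwards [(α.eventually_map k1).1 this, α.eventually_mem_src k1,
      (α.continuousAt k1).eventually ((β.continuousAt hβm).eventually
        (γ.symm.eventually_mem_src hm))] with z h1 h2 h3
    rw [α.symm_apply_apply h2] at h1
    nth_rewrite 1 [h1]
    exact γ.apply_symm_apply h3

/-- The composite of two natural isomorphisms. -/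
def transRel (f₁ : GMap A₁ B₁) (T₁₂ : GRel A₁ A₂ B₁ B₂) (T₂₃ : GRel A₂ A₃ B₂ B₃) :
    GRel A₁ A₃ B₁ B₃ := fun x φ χ =>
  x ∈ φ.src ∧ f₁.tot x ∈ χ.src ∧ ∃ a α b β, T₁₂ x a α ∧ T₂₃ (a x) b β ∧
    (φ =ᶠ[𝓝 x] fun y => b (a y)) ∧ χ =ᶠ[𝓝 (f₁.tot x)] fun z => β (α z)

theorem isGermRel_trans (h₁₂ : IsCell f₁ f₂ T₁₂) (h₂₃ : IsCell f₂ f₃ T₂₃) :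
    IsGermRel f₁.tot f₃.tot (transRel f₁ T₁₂ T₂₃) where
  mem h := h.1
  mem' h := h.2.1
  map_eq := by
    rintro x φ χ ⟨-, -, a, α, b, β, ha, hb, h, h'⟩
    rw [h'.eq_of_nhds, h₁₂.map_eq ha, h₂₃.map_eq hb, h.eq_of_nhds]
  exists_rel := by
    intro x φ hx
    -- The middle atlas covers the orbifold, so `φ` factors as `(φ ∘ a⁻¹) ∘ a` through a point of it
    -- over the same point.
    obtain ⟨x₂, hx₂⟩ := A₂.exists_proj_eq (A₁.proj x)
    obtain ⟨a, hxa, -⟩ := Trn.exists_of_proj_eq x x₂ hx₂.symm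
    obtain ⟨α, hα⟩ := h₁₂.exists_rel hxa
    have hb : a x ∈ (a.symm.trans φ).src := Trn.mem_trans_src (a.apply_mem_symm_src hxa) (by
      rwa [a.symm_apply_apply hxa])
    obtain ⟨β, hβ⟩ := h₂₃.exists_rel hb
    refine ⟨α.trans β, hx, Trn.mem_trans_src (h₁₂.mem' hα) ?_, a, α, _, β, hα, hβ, ?_,
      Filter.EventuallyEq.refl _ _⟩
    · rw [h₁₂.map_eq hα]; exact h₂₃.mem' hβ
    · filter_upwards [a.eventually_symm_apply_apply hxa] with y hy
      rw [Trn.trans_apply, hy]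
  congr := by
    rintro x φ χ φ' χ' ⟨-, -, a, α, b, β, ha, hb, h, h'⟩ hx hφ hx' hχ
    exact ⟨hx, hx', a, α, b, β, ha, hb, hφ.trans h, hχ.trans h'⟩
  eventually := by
    rintro x φ χ ⟨hx, hx', a, α, b, β, ha, hb, h, h'⟩
    have hc := f₁.continuous_tot.continuousAt (x := x)
    filter_upwards [φ.eventually_mem_src hx, hc.eventually (χ.eventually_mem_src hx'),
      h₁₂.eventually ha, (a.continuousAt (h₁₂.mem ha)).eventually (h₂₃.eventually hb),
      h.eventually_nhds, hc.eventually h'.eventually_nhds] with y h1 h2 h3 h4 h5 h6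
    exact ⟨h1, h2, a, α, b, β, h3, h4, h5, h6⟩

/-- The factorisation through the middle atlas is not unique, but two of them differ by a transition
of that atlas. Compatibility of both cells with `f₂` cancels it. -/
theorem trans (h₁₂ : IsCell f₁ f₂ T₁₂) (h₂₃ : IsCell f₂ f₃ T₂₃) :
    IsCell f₁ f₃ (transRel f₁ T₁₂ T₂₃) := by
  refine ⟨isGermRel_trans h₁₂ h₂₃, ?_, ?_⟩
  · rintro x a α b β c γ ha ⟨hb, hb', p, π, q, κ, hp, hq, e, e'⟩
      ⟨hc, hc', p', π', q', κ', hp', hq', k, k'⟩ h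
    have hxa := f₁.isGermRel.mem ha
    have hxp := h₁₂.mem hp
    have hxp' := h₁₂.mem hp'
    have hα := f₁.isGermRel.map_eq ha
    have hαm := f₁.isGermRel.mem' ha
    obtain ⟨ρ, hρ⟩ := h₁₂.exists_rel (φ := a.trans p) (Trn.mem_trans_src hxa hxp)
    have h1 := h₁₂.left ha hp hρ (Filter.EventuallyEq.refl _ _)
    -- The factorisations `c = q' ∘ p'` and `c = q ∘ (p ∘ a)` differ by `p ∘ a ∘ p'⁻¹`, to which
    -- `f₂` assigns `ξ`.
    have hl : p' x ∈ (p'.symm.trans (a.trans p)).src :=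
      Trn.mem_trans_src (p'.apply_mem_symm_src hxp') (by
        rw [p'.symm_apply_apply hxp']; exact Trn.mem_trans_src hxa hxp)
    obtain ⟨ξ, hξ⟩ := f₂.isGermRel.exists_rel hl
    have e1 : ∀ᶠ y in 𝓝 x, p'.symm (p' y) = y := p'.eventually_symm_apply_apply hxp'
    have h2 := h₁₂.right hp' hξ hρ (by
      filter_upwards [e1] with y hy
      simp only [Trn.trans_apply]
      rw [hy])
    have hq2 : T₂₃ ((p'.symm.trans (a.trans p)) (p' x)) q κ := by
      rw [Trn.trans_apply, p'.symm_apply_apply hxp']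
      exact hq
    have h3 := h₂₃.left hξ hq2 hq' (by
      refine (p'.eventually_map hxp').2 ?_
      filter_upwards [e1, k, h, (a.continuousAt hxa).eventually e] with y y1 y2 y3 y4
      simp only [Trn.trans_apply]
      rw [y1, ← y2, y3, y4])
    rw [← h₁₂.map_eq hp', ] at h3
    replace h3 := (π'.eventually_map (h₁₂.mem' hp')).1 h3
    rw [← hα] at e'
    filter_upwards [k', h3, h2, h1, (α.eventually_map hαm).1 e'] with z z1 z2 z3 z4 z5
    rw [z1, z2, ← z3, z4, z5]
  · rintro x a α b β c γ ⟨ha, ha', p, π, q, κ, hp, hq, e, e'⟩ hb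
      ⟨hc, hc', p', π', q', κ', hp', hq', k, k'⟩ h
    have hxp := h₁₂.mem hp
    have hxp' := h₁₂.mem hp'
    have hpq := h₂₃.mem hq
    have hax : a x = q (p x) := e.eq_of_nhds
    have hbx : q (p x) ∈ b.src := hax ▸ f₃.isGermRel.mem hb
    obtain ⟨ρ, hρ⟩ := h₂₃.exists_rel (φ := q.trans b) (Trn.mem_trans_src hpq hbx)
    rw [hax] at hb
    have h1 := h₂₃.right hq hb hρ (Filter.EventuallyEq.refl _ _)
    -- Here `c = q' ∘ p'` and `c = (b ∘ q) ∘ p` differ by `p ∘ p'⁻¹`.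
    have hl : p' x ∈ (p'.symm.trans p).src :=
      Trn.mem_trans_src (p'.apply_mem_symm_src hxp') (by
        rwa [p'.symm_apply_apply hxp'])
    obtain ⟨ξ, hξ⟩ := f₂.isGermRel.exists_rel hl
    have e1 : ∀ᶠ y in 𝓝 x, p'.symm (p' y) = y := p'.eventually_symm_apply_apply hxp'
    have h2 := h₁₂.right hp' hξ hp (by
      filter_upwards [e1] with y hy
      simp only [Trn.trans_apply]
      rw [hy])
    have hq2 : T₂₃ ((p'.symm.trans p) (p' x)) (q.trans b) ρ := by
      rw [Trn.trans_apply, p'.symm_apply_apply hxp']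
      exact hρ
    have h3 := h₂₃.left hξ hq2 hq' (by
      refine (p'.eventually_map hxp').2 ?_
      filter_upwards [e1, k, h, e] with y y1 y2 y3 y4
      simp only [Trn.trans_apply]
      rw [y1, ← y2, y3, y4])
    rw [← h₁₂.map_eq hp', ] at h3
    replace h3 := (π'.eventually_map (h₁₂.mem' hp')).1 h3
    rw [← h₁₂.map_eq hp] at h1
    filter_upwards [k', h3, h2, (π.eventually_map (h₁₂.mem' hp)).1 h1, e'] with z z1 z2 z3 z4 z5
    rw [z1, z2, ← z3, z4, z5]

end IsCell

namespace GMap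

variable {A A₁ A₂ : OrbAtlas O} {B B₁ B₂ : OrbAtlas O'} {C C₁ C₂ : OrbAtlas O''}

/-- The composition of assignments of germs. -/
def comp (g : GMap B C) (f : GMap A B) : GMap A C where
  toFun := g.toFun ∘ f.toFun
  tot := g.tot ∘ f.tot
  rel := g.rel.comp f.tot f.rel
  continuous_toFun := g.continuous_toFun.comp f.continuous_toFun
  continuous_tot := g.continuous_tot.comp f.continuous_tot
  proj_tot x := (g.proj_tot _).trans (congrArg _ (f.proj_tot x))
  isGermRel := g.isGermRel.comp f.continuous_tot f.isGermRel
  tri := g.tri.comp f.isGermRel f.tri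

end GMap

/-- Horizontal composition: the source of the compatibility of composition with equivalence of
charted maps. -/
theorem IsCell.comp {A₁ A₂ : OrbAtlas O} {B₁ B₂ : OrbAtlas O'} {C₁ C₂ : OrbAtlas O''}
    {f₁ : GMap A₁ B₁} {f₂ : GMap A₂ B₂} {g₁ : GMap B₁ C₁} {g₂ : GMap B₂ C₂}
    {T : GRel A₁ A₂ B₁ B₂} {S : GRel B₁ B₂ C₁ C₂} (hS : IsCell g₁ g₂ S) (hT : IsCell f₁ f₂ T) :
    IsCell (g₁.comp f₁) (g₂.comp f₂) (S.comp f₁.tot T) where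
  toIsGermRel := hS.toIsGermRel.comp f₁.continuous_tot hT.toIsGermRel
  left := hS.left.comp f₁.isGermRel hT.left
  right := hS.right.comp hT.toIsGermRel hT.right

/-- One inclusion suffices, because every germ is assigned exactly one germ by each side. -/
theorem GMap.ext_of_le {A : OrbAtlas O} {B : OrbAtlas O'} {f g : GMap A B}
    (h₁ : f.toFun = g.toFun) (h₂ : f.tot = g.tot)
    (h : ∀ x φ χ, f.rel x φ χ → g.rel x φ χ) : f = g := by
  refine GMap.ext h₁ h₂ (funext fun x => funext fun φ => funext fun χ =>
    propext ⟨h x φ χ, fun hg => ?_⟩)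
  obtain ⟨χ', hf⟩ := f.isGermRel.exists_rel (g.isGermRel.mem hg)
  have := g.isCell_rel.germ_unique hg (h _ _ _ hf) (Filter.EventuallyEq.refl _ _)
  have hm := g.isGermRel.mem' hg
  rw [← h₂] at this hm
  exact f.isGermRel.congr hf (f.isGermRel.mem hf) (Filter.EventuallyEq.refl _ _) hm this

end Maps

/-! ### Small charts -/

section SmallCharts

variable {n : ℕ} {Q : Type u} [TopologicalSpace Q]

open TopologicalSpace

namespace OrbChart

/-- An open subset is stable at `x` if it is preserved by the isotropy group of `x` and moved off
itself by the other elements of the group. -/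
def IsStable (c : OrbChart n Q) (x : c.V) (S : Set c.V) : Prop :=
  (∀ g ∈ c.G, g x = x → ∀ y ∈ S, g y ∈ S) ∧ ∀ g ∈ c.G, ∀ y ∈ S, g y ∈ S → g x = x

/-- Finiteness of the group and the Hausdorff property give a neighbourhood moved off itself by
every element not fixing `x`. Intersecting its preimages under the isotropy group makes it
invariant, and passing to the connected component of `x` keeps both properties. -/
theorem exists_isStable (c : OrbChart n Q) (x : c.V) {U : Set c.V} (hU : IsOpen U) (hx : x ∈ U) :
    ∃ S : Set c.V, IsOpen S ∧ IsConnected S ∧ x ∈ S ∧ S ⊆ U ∧ c.IsStable x S := by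
  have := c.finite_G
  have := ChartedSpace.locallyConnectedSpace (EuclideanSpace ℝ (Fin n)) c.V
  have h1 : ∀ g : c.G, ∃ W : Set c.V, IsOpen W ∧ x ∈ W ∧ W ⊆ U ∧
      (g.1 x ≠ x → ∀ y ∈ W, g.1 y ∉ W) := by
    intro g
    by_cases hg : g.1 x = x
    · exact ⟨U, hU, hx, subset_rfl, fun h => absurd hg h⟩
    · obtain ⟨W₁, W₂, o1, o2, m1, m2, hd⟩ := t2_separation hg
      refine ⟨U ∩ (W₂ ∩ g.1 ⁻¹' W₁), hU.inter (o2.inter (o1.preimage g.1.continuous)),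
        ⟨hx, m2, m1⟩, Set.inter_subset_left, fun _ y hy hy' => ?_⟩
      exact Set.disjoint_left.1 hd hy.2.2 hy'.2.1
  choose W oW mW sW dW using h1
  set W₁ : Set c.V := ⋂ g, W g with hW₁
  have oW₁ : IsOpen W₁ := isOpen_iInter_of_finite oW
  set W₂ : Set c.V := ⋂ g : {g : c.G // g.1 x = x}, g.1.1 ⁻¹' W₁ with hW₂
  have oW₂ : IsOpen W₂ := isOpen_iInter_of_finite fun g => oW₁.preimage g.1.1.continuous
  have mW₂ : x ∈ W₂ := Set.mem_iInter.2 fun g => by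
    rw [Set.mem_preimage, g.2]
    exact Set.mem_iInter.2 mW
  have sW₂ : W₂ ⊆ W₁ := fun y hy => Set.mem_iInter.1 hy ⟨1, rfl⟩
  have inv : ∀ g ∈ c.G, g x = x → ∀ y ∈ W₂, g y ∈ W₂ := by
    intro g hg hgx y hy
    refine Set.mem_iInter.2 fun k => ?_
    have hk : (k.1 * ⟨g, hg⟩ : c.G).1 x = x := by
      change k.1.1 (g x) = x
      rw [hgx, k.2]
    exact Set.mem_iInter.1 hy ⟨k.1 * ⟨g, hg⟩, hk⟩
  refine ⟨connectedComponentIn W₂ x, oW₂.connectedComponentIn,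
    isConnected_connectedComponentIn_iff.2 mW₂, mem_connectedComponentIn mW₂, fun y hy =>
      sW 1 (Set.mem_iInter.1 (sW₂ (connectedComponentIn_subset _ _ hy)) 1), ?_, ?_⟩
  · intro g hg hgx y hy
    -- The image of the component is connected and contains `g x = x`, so it stays in the component.
    have hp : IsPreconnected (g '' connectedComponentIn W₂ x) :=
      isPreconnected_connectedComponentIn.image _ g.continuous.continuousOn
    refine hp.subset_connectedComponentIn ⟨x, mem_connectedComponentIn mW₂, hgx⟩ ?_ ⟨y, hy, rfl⟩
    rintro _ ⟨z, hz, rfl⟩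
    exact inv g hg hgx z (connectedComponentIn_subset _ _ hz)
  · intro g hg y hy hgy
    by_contra hne
    exact dW ⟨g, hg⟩ hne y
      (Set.mem_iInter.1 (sW₂ (connectedComponentIn_subset _ _ hy)) ⟨g, hg⟩)
      (Set.mem_iInter.1 (sW₂ (connectedComponentIn_subset _ _ hgy)) ⟨g, hg⟩)

theorem contMDiffOn_subtypeCoe_symm {V : Type*} [TopologicalSpace V]
    [ChartedSpace (EuclideanSpace ℝ (Fin n)) V] (S : Opens V) (hS : Nonempty S) :
    ContMDiffOn (𝓡 n) (𝓡 n) ∞ (S.openPartialHomeomorphSubtypeCoe hS).symm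
      (S.openPartialHomeomorphSubtypeCoe hS).target := by
  intro y hy
  refine (ContMDiffWithinAt.subtypeVal_comp_iff S _ _ y).1 ?_
  refine contMDiffWithinAt_id.congr_of_mem (fun z hz => ?_) hy
  exact (S.openPartialHomeomorphSubtypeCoe hS).right_inv hz

theorem isLocalDiffeomorph_subtypeVal {V : Type*} [TopologicalSpace V]
    [ChartedSpace (EuclideanSpace ℝ (Fin n)) V] (S : Opens V) :
    IsLocalDiffeomorph (𝓡 n) (𝓡 n) ∞ (Subtype.val : S → V) := fun x =>
  ⟨{ toPartialEquiv := (S.openPartialHomeomorphSubtypeCoe ⟨x⟩).toPartialEquiv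
     open_source := (S.openPartialHomeomorphSubtypeCoe ⟨x⟩).open_source
     open_target := (S.openPartialHomeomorphSubtypeCoe ⟨x⟩).open_target
     contMDiffOn_toFun := contMDiff_subtype_val.contMDiffOn
     contMDiffOn_invFun := contMDiffOn_subtypeCoe_symm S ⟨x⟩ }, Set.mem_univ x, fun _ _ => rfl⟩

/-- The restriction of an orbifold chart to a stable connected open subset. -/
noncomputable def restrict (c : OrbChart n Q) (x : c.V) (S : Opens c.V)
    (hc : IsConnected (S : Set c.V))
    (hS : c.IsStable x S) : OrbChart n Q where
  V := S
  connectedV := isConnected_iff_connectedSpace.1 hc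
  G :=
    { carrier := {h | ∃ g ∈ c.G, g x = x ∧ ∀ s : S, (h s : c.V) = g s}
      mul_mem' := by
        rintro h k ⟨g, hg, gx, e⟩ ⟨g', hg', gx', e'⟩
        refine ⟨g * g', c.G.mul_mem hg hg', ?_, fun s => ?_⟩
        · change g (g' x) = x
          rw [gx', gx]
        · change ((h (k s) : S) : c.V) = g (g' s)
          rw [e, e']
      one_mem' := ⟨1, c.G.one_mem, rfl, fun _ => rfl⟩
      inv_mem' := by
        rintro h ⟨g, hg, gx, e⟩
        refine ⟨g⁻¹, c.G.inv_mem hg, ?_, fun s => ?_⟩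
        · exact (g.symm_apply_eq).2 gx.symm
        · refine ((g.symm_apply_eq).2 ?_).symm
          rw [← e]
          exact congrArg Subtype.val (h.apply_symm_apply s).symm }
  finite_G := by
    have := c.finite_G
    let F : {h : S ≃ₜ S | ∃ g ∈ c.G, g x = x ∧ ∀ s : S, (h s : c.V) = g s} → c.G :=
      fun h => ⟨h.2.choose, h.2.choose_spec.1⟩
    refine Finite.of_injective F fun h k hhk => ?_
    refine Subtype.ext (Homeomorph.ext fun s => Subtype.ext ?_)
    rw [h.2.choose_spec.2.2 s, k.2.choose_spec.2.2 s]
    exact congrArg (fun g : c.G => g.1 (s : c.V)) hhk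
  smooth_G := by
    rintro h ⟨g, hg, -, e⟩
    refine (ContMDiff.subtypeVal_comp_iff S _).1 ?_
    have : Subtype.val ∘ h = g ∘ Subtype.val := funext e
    rw [this]
    exact (c.smooth_G g hg).comp contMDiff_subtype_val
  π s := c.π s
  continuous_π := c.continuous_π.comp continuous_subtype_val
  isOpenMap_π := c.isOpenMap_π.comp S.isOpen.isOpenMap_subtype_val
  π_eq_iff s t := by
    rw [c.π_eq_iff]
    constructor
    · rintro ⟨g, hg, e⟩
      -- An element carrying a point of `S` into `S` lies in the isotropy group, hence restricts to
      -- `S`; no identifications are lost in the smaller chart.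
      have gx : g x = x := hS.2 g hg s s.2 (e ▸ t.2)
      have gx' : g.symm x = x := (g.symm_apply_eq).2 gx.symm
      refine ⟨g.subtype fun y => ⟨hS.1 g hg gx y, fun h => ?_⟩, ⟨g, hg, gx, fun _ => rfl⟩,
        Subtype.ext e⟩
      have := hS.1 _ (c.G.inv_mem hg) gx' _ h
      exact (g.symm_apply_apply y) ▸ this
    · rintro ⟨h, ⟨g, hg, -, e⟩, rfl⟩
      exact ⟨g, hg, (e s).symm⟩

/-- By maximality only compatibility is needed, and matching diffeomorphisms of `c` are composed
with the inclusion of `S`. -/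
theorem restrict_mem {O : OrbifoldStructure n Q} {c : OrbChart n Q} (h : c ∈ O.charts) (x : c.V)
    (S : Opens c.V) (hc : IsConnected (S : Set c.V)) (hS : c.IsStable x S) :
    c.restrict x S hc hS ∈ O.charts := by
  refine O.maximal _ fun d hd (s : S) y hsy => ?_
  obtain ⟨k, m1, m2, s1, s2, hp⟩ := O.compatible c h d hd s y hsy
  let σ := S.openPartialHomeomorphSubtypeCoe ⟨s⟩
  refine ⟨σ.trans k, ⟨Set.mem_univ s, m1⟩, m2, ?_, ?_, fun z hz => hp _ hz.2⟩
  · exact s1.comp contMDiff_subtype_val.contMDiffOn fun z hz => hz.2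
  · exact (contMDiffOn_subtypeCoe_symm S ⟨s⟩).comp (s2.mono fun z hz => hz.1) fun z hz => hz.2

theorem restrict_isEmbedding (c : OrbChart n Q) (x : c.V)
    (S : Opens c.V) (hc : IsConnected (S : Set c.V)) (hS : c.IsStable x S) :
    (c.restrict x S hc hS).IsEmbedding c (Subtype.val : S → c.V) :=
  ⟨S.isOpenEmbedding', isLocalDiffeomorph_subtypeVal S, fun _ => rfl⟩

end OrbChart

/-- Every neighbourhood of a point of an atlas contains an embedded chart of the orbifold. -/
theorem OrbAtlas.exists_small_chart {O : OrbifoldStructure n Q} (A : OrbAtlas O) (x : A.Total)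
    {U : Set A.Total} (hU : U ∈ 𝓝 x) :
    ∃ d ∈ O.charts, ∃ e : d.V → (A.chart x.1).V, d.IsEmbedding (A.chart x.1) e ∧
      x ∈ Sigma.mk x.1 '' Set.range e ∧ Sigma.mk x.1 '' Set.range e ⊆ U := by
  obtain ⟨i, x⟩ := x
  obtain ⟨W, hWU, oW, hxW⟩ := mem_nhds_iff.1 hU
  obtain ⟨S, oS, cS, hxS, hSW, hS⟩ := (A.chart i).exists_isStable x
    (oW.preimage continuous_sigmaMk) hxW
  refine ⟨(A.chart i).restrict x ⟨S, oS⟩ cS hS, OrbChart.restrict_mem (A.chart_mem i) _ _ _ _,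
    Subtype.val, OrbChart.restrict_isEmbedding _ _ _ _ _, ?_, ?_⟩
  · exact ⟨x, ⟨⟨x, hxS⟩, rfl⟩, rfl⟩
  · rintro _ ⟨_, ⟨s, rfl⟩, rfl⟩
    exact hWU (hSW s.2)

end SmallCharts

/-! ### Local diffeomorphisms between atlases of an orbifold -/

section Etale

variable {n : ℕ} {Q : Type u} [TopologicalSpace Q] {O : OrbifoldStructure n Q}
  {A B : OrbAtlas O}

/-- A map between the disjoint unions of the charts which is locally a transition. -/
def IsEtale (ψ : A.Total → B.Total) : Prop :=
  ∀ x, ∃ e : Trn A B, x ∈ e.src ∧ ∀ y ∈ e.src, ψ y = e y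

theorem isEtale_of_eventuallyEq {ψ : A.Total → B.Total}
    (h : ∀ x, ∃ e : Trn A B, x ∈ e.src ∧ ψ =ᶠ[𝓝 x] e) : IsEtale ψ := by
  intro x
  obtain ⟨e, hx, he⟩ := h x
  refine ⟨e.restr {y | ∀ᶠ z in 𝓝 y, ψ z = e z} isOpen_setOfPred_eventually_nhds, ?_, ?_⟩
  · rw [Trn.restr_src]; exact ⟨hx, he⟩
  · intro y hy
    rw [Trn.restr_src] at hy
    exact hy.2.self_of_nhds

namespace IsEtale

variable {ψ : A.Total → B.Total} (hψ : IsEtale ψ)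

theorem isEtale_id : IsEtale (id : A.Total → A.Total) :=
  fun x => ⟨Trn.refl A, Trn.mem_refl_src x, fun _ _ => rfl⟩

include hψ

theorem exists_trn (x : A.Total) : ∃ e : Trn A B, x ∈ e.src ∧ ψ x = e x ∧ ψ =ᶠ[𝓝 x] e := by
  obtain ⟨e, hx, he⟩ := hψ x
  exact ⟨e, hx, he x hx, (e.eventually_mem_src hx).mono he⟩

theorem continuous : Continuous ψ := continuous_iff_continuousAt.2 fun x => by
  obtain ⟨e, hx, -, he⟩ := hψ.exists_trn x
  exact (e.continuousAt hx).congr he.symm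

theorem contMDiff : ContMDiff (𝓡 n) (𝓡 n) ∞ ψ := fun x => by
  obtain ⟨e, hx, -, he⟩ := hψ.exists_trn x
  exact (e.contMDiffAt hx).congr_of_eventuallyEq he

theorem proj_apply (x : A.Total) : B.proj (ψ x) = A.proj x := by
  obtain ⟨e, hx, h, -⟩ := hψ.exists_trn x
  rw [h, e.proj_apply hx]

theorem eventually_map {x : A.Total} {p : B.Total → Prop} :
    (∀ᶠ y in 𝓝 (ψ x), p y) ↔ ∀ᶠ y in 𝓝 x, p (ψ y) := by
  obtain ⟨e, hx, h, he⟩ := hψ.exists_trn x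
  rw [h, e.eventually_map hx]
  exact Filter.eventually_congr (he.mono fun y hy => by rw [hy])

/-- Local injectivity of `ψ` gives local uniqueness of continuous lifts through it. -/
theorem eventuallyEq_of_comp {X : Type*} [TopologicalSpace X] {f g : X → A.Total} {x : X}
    (hf : ContinuousAt f x) (hg : ContinuousAt g x) (hfg : f x = g x)
    (h : ∀ᶠ y in 𝓝 x, ψ (f y) = ψ (g y)) : f =ᶠ[𝓝 x] g := by
  obtain ⟨e, hx, he⟩ := hψ (f x)
  have hx' : e.src ∈ 𝓝 (g x) := hfg ▸ e.src_mem_nhds hx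
  filter_upwards [h, hf.eventually (e.eventually_mem_src hx), hg.eventually hx'] with y h1 h2 h3
  rw [he _ h2, he _ h3] at h1
  exact e.injOn h2 h3 h1

end IsEtale

/-- The transitions `φ`, `χ` correspond to each other under the local diffeomorphism `ψ`. -/
def liftRel (ψ : A.Total → B.Total) : GRel A A B B := fun x φ χ =>
  x ∈ φ.src ∧ ψ x ∈ χ.src ∧ ∀ᶠ y in 𝓝 x, χ (ψ y) = ψ (φ y)

theorem isGermRel_liftRel {ψ : A.Total → B.Total} (hψ : IsEtale ψ) :
    IsGermRel ψ ψ (liftRel ψ) where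
  mem h := h.1
  mem' h := h.2.1
  map_eq h := h.2.2.self_of_nhds
  exists_rel := by
    intro x φ hx
    obtain ⟨e, he, k, ke⟩ := hψ.exists_trn x
    obtain ⟨e', he', k', ke'⟩ := hψ.exists_trn (φ x)
    -- The corresponding germ is `φ` conjugated by local branches of `ψ` at `x` and at `φ x`.
    refine ⟨e.symm.trans (φ.trans e'), hx, ?_, ?_⟩
    · rw [k]
      refine Trn.mem_trans_src (e.apply_mem_symm_src he) ?_
      rw [e.symm_apply_apply he]
      exact Trn.mem_trans_src hx he'
    · filter_upwards [ke, e.eventually_symm_apply_apply he,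
        (φ.continuousAt hx).eventually ke'] with y h1 h2 h3
      rw [h1, Trn.trans_apply, h2, Trn.trans_apply, h3]
  congr := by
    rintro x φ χ φ' χ' ⟨h1, h2, h3⟩ hx hφ hx' hχ
    refine ⟨hx, hx', ?_⟩
    filter_upwards [h3, hφ, hψ.continuous.continuousAt.eventually hχ] with y k1 k2 k3
    rw [k3, k1, k2]
  eventually := by
    rintro x φ χ ⟨h1, h2, h3⟩
    filter_upwards [φ.eventually_mem_src h1,
      hψ.continuous.continuousAt.eventually (χ.eventually_mem_src h2), h3.eventually_nhds]
      with y k1 k2 k3 using ⟨k1, k2, k3⟩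

theorem tri_liftRel {ψ : A.Total → B.Total} (hψ : IsEtale ψ) :
    Tri ψ (liftRel ψ) (liftRel ψ) (liftRel ψ) := by
  rintro x a α b β c γ ⟨a1, a2, a3⟩ ⟨b1, b2, b3⟩ ⟨c1, c2, c3⟩ h
  refine hψ.eventually_map.2 ?_
  filter_upwards [a3, (a.continuousAt a1).eventually b3, c3, h] with y h1 h2 h3 h4
  rw [h3, h1, h2, h4]

/-- The assignment of germs induced by a local diffeomorphism over the identity. -/
def GMap.ofEtale (ψ : A.Total → B.Total) (hψ : IsEtale ψ) : GMap A B where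
  toFun := id
  tot := ψ
  rel := liftRel ψ
  continuous_toFun := continuous_id
  continuous_tot := hψ.continuous
  proj_tot := hψ.proj_apply
  isGermRel := isGermRel_liftRel hψ
  tri := tri_liftRel hψ

/-- Equivariance at all points near `x` prescribes the assigned germ on the image of `f.tot`, which
is open. A lift of the identity thus has no freedom beyond its map on points. -/
theorem GMap.eq_ofEtale {f : GMap A B} (hf : f.toFun = id) (hψ : IsEtale f.tot) :
    f = GMap.ofEtale f.tot hψ :=
  GMap.ext_of_le hf rfl fun _ _ _ h => ⟨f.isGermRel.mem h, f.isGermRel.mem' h,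
    (f.isGermRel.eventually h).mono fun _ => f.isGermRel.map_eq⟩

end Etale

/-! ### Charted maps related by lifts of the identity -/

section Pullback

variable {n n' : ℕ} {Q Q' : Type u} [TopologicalSpace Q] [TopologicalSpace Q']
  {O : OrbifoldStructure n Q} {O' : OrbifoldStructure n' Q'}
  {A W : OrbAtlas O} {B W' : OrbAtlas O'}

/-- The assignment of germs induced on finer atlases. -/
def pullbackRel (f : GMap A B) (j : W.Total → A.Total) (j' : W'.Total → B.Total)
    (h : W.Total → W'.Total) : GRel W W W' W' := fun x φ χ =>
  -- As `j'` need not be injective, several germs `χ` lie over `χ'`; the first condition selects the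
  -- one ending at `h (φ x)`.
  χ (h x) = h (φ x) ∧ ∃ φ' χ', liftRel j x φ φ' ∧ f.rel (j x) φ' χ' ∧ liftRel j' (h x) χ χ'

variable {f : GMap A B} {j : W.Total → A.Total} {j' : W'.Total → B.Total}
  {h : W.Total → W'.Total}

theorem isGermRel_pullbackRel (hj : IsEtale j) (hj' : IsEtale j') (hc : Continuous h)
    (e : ∀ x, j' (h x) = f.tot (j x)) : IsGermRel h h (pullbackRel f j j' h) where
  mem := by rintro x φ χ ⟨-, φ', χ', h1, h2, h3⟩; exact h1.1
  mem' := by rintro x φ χ ⟨-, φ', χ', h1, h2, h3⟩; exact h3.1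
  map_eq := by rintro x φ χ ⟨h0, -⟩; exact h0
  exists_rel := by
    intro x φ hx
    obtain ⟨φ', h1⟩ := (isGermRel_liftRel hj).exists_rel hx
    obtain ⟨χ', h2⟩ := f.isGermRel.exists_rel h1.2.1
    obtain ⟨p, hp, k, kp⟩ := hj'.exists_trn (h x)
    obtain ⟨q, hq, l, lq⟩ := hj'.exists_trn (h (φ x))
    have hm : p (h x) ∈ χ'.src := by rw [← k, e]; exact f.isGermRel.mem' h2
    have hv : χ' (p (h x)) = q (h (φ x)) := by
      rw [← k, e, f.isGermRel.map_eq h2, h1.2.2.self_of_nhds, ← l, e]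
    have hq' : χ' (p (h x)) ∈ q.symm.src := hv ▸ q.apply_mem_symm_src hq
    have hm' : h x ∈ (p.trans (χ'.trans q.symm)).src :=
      Trn.mem_trans_src hp (Trn.mem_trans_src hm hq')
    have hval : (p.trans (χ'.trans q.symm)) (h x) = h (φ x) := by
      rw [Trn.trans_apply, Trn.trans_apply, hv, q.symm_apply_apply hq]
    -- The germ is `q⁻¹ ∘ χ' ∘ p`, with `p` and `q` the branches of `j'` at `h x` and at `h (φ x)`.
    refine ⟨p.trans (χ'.trans q.symm), hval, φ', χ', h1, h2, hm', ?_, ?_⟩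
    · rw [k]; exact hm
    · have ht := (p.trans (χ'.trans q.symm)).continuousAt hm'
      rw [ContinuousAt, hval] at ht
      have ht' := (χ'.continuousAt hm).eventually (q.symm.eventually_mem_src hq')
      filter_upwards [ht.eventually lq, kp, (p.continuousAt hp).eventually ht'] with z z1 z2 z3
      rw [z1, z2, Trn.trans_apply, Trn.trans_apply, q.apply_symm_apply z3]
  congr := by
    rintro x φ χ φ' χ' ⟨h0, φ₁, χ₁, h1, h2, h3⟩ hx hφ hx' hχ
    refine ⟨?_, φ₁, χ₁, ?_, h2, ?_⟩
    · rw [hχ.eq_of_nhds, hφ.eq_of_nhds, h0]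
    · exact (isGermRel_liftRel hj).congr h1 hx hφ h1.2.1 (Filter.EventuallyEq.refl _ _)
    · exact (isGermRel_liftRel hj').congr h3 hx' hχ h3.2.1 (Filter.EventuallyEq.refl _ _)
  eventually := by
    rintro x φ χ ⟨h0, φ', χ', h1, h2, h3⟩
    have k1 := (isGermRel_liftRel hj).eventually h1
    have k2 := hj.continuous.continuousAt.eventually (f.isGermRel.eventually h2)
    have k3 := hc.continuousAt.eventually ((isGermRel_liftRel hj').eventually h3)
    -- The endpoint condition spreads from `x` to a neighbourhood: both sides are continuous lifts
    -- through `j'` of the same map.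
    have : (fun y => χ (h y)) =ᶠ[𝓝 x] fun y => h (φ y) := by
      refine hj'.eventuallyEq_of_comp (ContinuousAt.comp (χ.continuousAt h3.1) hc.continuousAt)
        (ContinuousAt.comp hc.continuousAt (φ.continuousAt h1.1)) h0 ?_
      filter_upwards [k1, k2, k3] with y y1 y2 y3
      rw [← y3.2.2.self_of_nhds, e, f.isGermRel.map_eq y2, y1.2.2.self_of_nhds, e]
    filter_upwards [k1, k2, k3, this] with y y1 y2 y3 y4
    exact ⟨y4, φ', χ', y1, y2, y3⟩

theorem tri_pullbackRel (hj : IsEtale j) (hj' : IsEtale j')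
    (e : ∀ x, j' (h x) = f.tot (j x)) :
    Tri h (pullbackRel f j j' h) (pullbackRel f j j' h) (pullbackRel f j j' h) := by
  rintro x a α b β c γ ⟨a0, a', α', a1, a2, a3⟩ ⟨b0, b', β', b1, b2, b3⟩
    ⟨c0, c', γ', c1, c2, c3⟩ hh
  have hax : a' (j x) = j (a x) := a1.2.2.self_of_nhds
  rw [← hax] at b2
  have key := f.tri a2 b2 c2 (tri_liftRel hj a1 b1 c1 hh)
  rw [← e, Filter.EventuallyEq, hj'.eventually_map] at key
  rw [← a0] at b3
  refine hj'.eventuallyEq_of_comp (γ.continuousAt c3.1)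
    (ContinuousAt.comp (β.continuousAt b3.1) (α.continuousAt a3.1)) ?_ ?_
  · rw [c0, a0, b0, hh.eq_of_nhds]
  · filter_upwards [key, c3.2.2, a3.2.2, (α.continuousAt a3.1).eventually b3.2.2]
      with z z1 z2 z3 z4
    rw [← z2, z1, z3, z4]

/-- The charted map induced on finer atlases. -/
def GMap.pullback (f : GMap A B) (h : W.Total → W'.Total) (hj : IsEtale j) (hj' : IsEtale j')
    (hc : Continuous h) (e : ∀ x, j' (h x) = f.tot (j x)) : GMap W W' where
  toFun := f.toFun
  tot := h
  rel := pullbackRel f j j' h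
  continuous_toFun := f.continuous_toFun
  continuous_tot := hc
  proj_tot x := by rw [← hj'.proj_apply, e, f.proj_tot, hj.proj_apply]
  isGermRel := isGermRel_pullbackRel hj hj' hc e
  tri := tri_pullbackRel hj hj' e

theorem GMap.comp_pullback (hj : IsEtale j) (hj' : IsEtale j') (hc : Continuous h)
    (e : ∀ x, j' (h x) = f.tot (j x)) :
    f.comp (GMap.ofEtale j hj) = (GMap.ofEtale j' hj').comp (f.pullback h hj hj' hc e) := by
  have ht : ((GMap.ofEtale j' hj').comp (f.pullback h hj hj' hc e)).tot =
      (f.comp (GMap.ofEtale j hj)).tot := funext e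
  symm
  refine GMap.ext_of_le (f := (GMap.ofEtale j' hj').comp (f.pullback h hj hj' hc e))
    (g := f.comp (GMap.ofEtale j hj)) rfl ht ?_
  rintro x φ χ₁ ⟨χ, ⟨h0, φ', χ', h1, h2, h3⟩, h4⟩
  refine ⟨φ', h1, f.isGermRel.congr h2 h1.2.1 (Filter.EventuallyEq.refl _ _) ?_ ?_⟩
  · change f.tot (j x) ∈ _
    rw [← e]; exact h4.2.1
  · change _ =ᶠ[𝓝 (f.tot (j x))] _
    rw [← e]
    refine hj'.eventually_map.2 ?_
    filter_upwards [h3.2.2, h4.2.2] with z z1 z2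
    rw [z1, z2]

/-- Equality of the composites says that some germ assigned by `h` lies under `χ'`; uniqueness of
assigned germs identifies it with `χ`. -/
theorem GMap.liftRel_of_comp_eq {f : GMap A B} {h : GMap W W'} (hj : IsEtale j)
    (hj' : IsEtale j') (H : f.comp (GMap.ofEtale j hj) = (GMap.ofEtale j' hj').comp h)
    {x : W.Total} {φ : Trn W W} {φ' : Trn A A} {χ : Trn W' W'} {χ' : Trn B B}
    (h1 : liftRel j x φ φ') (h2 : f.rel (j x) φ' χ') (h3 : h.rel x φ χ) :
    liftRel j' (h.tot x) χ χ' := by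
  have : (f.comp (GMap.ofEtale j hj)).rel x φ χ' := ⟨φ', h1, h2⟩
  rw [H] at this
  obtain ⟨χ₂, k1, k2⟩ := this
  have := h.isCell_rel.germ_unique h3 k1 (Filter.EventuallyEq.refl _ _)
  exact (isGermRel_liftRel hj').congr k2 (h.isGermRel.mem' h3) this k2.2.1
    (Filter.EventuallyEq.refl _ _)

/-- If `f ∘ ε = ε' ∘ h` with `ε`, `ε'` lifts of the identity, then `h` is isomorphic to `f`. -/
theorem exists_isCell_of_comp_eq {f : GMap A B} {h : GMap W W'} (hj : IsEtale j)
    (hj' : IsEtale j') (H : f.comp (GMap.ofEtale j hj) = (GMap.ofEtale j' hj').comp h) :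
    ∃ T, IsCell h f T := by
  have e : ∀ x, f.tot (j x) = j' (h.tot x) := congrFun (congrArg GMap.tot H)
  -- Every germ from `W` to `A` is that of `j` followed by a transition `φ` of `A`. It is sent to
  -- `j'` followed by a germ that `f` assigns to `φ`.
  refine ⟨fun x a χ => x ∈ a.src ∧ h.tot x ∈ χ.src ∧ ∃ φ χ', f.rel (j x) φ χ' ∧
    (∀ᶠ y in 𝓝 x, a y = φ (j y)) ∧ ∀ᶠ z in 𝓝 (h.tot x), χ z = χ' (j' z),
    ⟨⟨fun h => h.1, fun h => h.2.1, ?_, ?_, ?_, ?_⟩, ?_, ?_⟩⟩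
  · rintro x a χ ⟨-, -, φ, χ', h1, h2, h3⟩
    rw [h3.self_of_nhds, h2.self_of_nhds, ← e, f.isGermRel.map_eq h1]
  · intro x a hx
    obtain ⟨p, hp, k, kp⟩ := hj.exists_trn x
    obtain ⟨q, hq, l, lq⟩ := hj'.exists_trn (h.tot x)
    have hm : j x ∈ (p.symm.trans a).src := by
      rw [k]
      refine Trn.mem_trans_src (p.apply_mem_symm_src hp) ?_
      rwa [p.symm_apply_apply hp]
    obtain ⟨χ', h1⟩ := f.isGermRel.exists_rel hm
    refine ⟨q.trans χ', hx, Trn.mem_trans_src hq ?_, _, χ', h1, ?_, ?_⟩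
    · rw [← l, ← e]; exact f.isGermRel.mem' h1
    · filter_upwards [kp, p.eventually_symm_apply_apply hp] with y y1 y2
      rw [y1, Trn.trans_apply, y2]
    · filter_upwards [lq] with z hz
      rw [hz, Trn.trans_apply]
  · rintro x a χ a' χ₁ ⟨-, -, φ, χ', h1, h2, h3⟩ hx ha hx' hχ
    refine ⟨hx, hx', φ, χ', h1, ?_, ?_⟩
    · filter_upwards [h2, ha] with y y1 y2
      rw [y2, y1]
    · filter_upwards [h3, hχ] with y y1 y2
      rw [y2, y1]
  · rintro x a χ ⟨hx, hx', φ, χ', h1, h2, h3⟩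
    filter_upwards [a.eventually_mem_src hx,
      h.continuous_tot.continuousAt.eventually (χ.eventually_mem_src hx'),
      hj.continuous.continuousAt.eventually (f.isGermRel.eventually h1), h2.eventually_nhds,
      h.continuous_tot.continuousAt.eventually h3.eventually_nhds] with y y1 y2 y3 y4 y5
    exact ⟨y1, y2, φ, χ', y3, y4, y5⟩
  · rintro x μ ξ a α c γ h1 ⟨a1, a2, φ, χ, a3, a4, a5⟩ ⟨c1, c2, φ₂, χ₂, c3, c4, c5⟩ hh
    have hμ := h.isGermRel.mem h1
    have hξ := h.isGermRel.mem' h1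
    obtain ⟨μ', k1⟩ := (isGermRel_liftRel hj).exists_rel hμ
    obtain ⟨ξ', k2⟩ := f.isGermRel.exists_rel k1.2.1
    have k3 := GMap.liftRel_of_comp_eq hj hj' H k1 k2 h1
    rw [← show μ' (j x) = j (μ x) from k1.2.2.self_of_nhds] at a3
    have key := f.tri k2 a3 c3 (by
      refine hj.eventually_map.2 ?_
      filter_upwards [c4, hh, (μ.continuousAt hμ).eventually a4, k1.2.2] with y y1 y2 y3 y4
      rw [← y1, y2, y3, y4])
    rw [e, Filter.EventuallyEq, hj'.eventually_map] at key
    rw [← h.isGermRel.map_eq h1] at a5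
    filter_upwards [key, c5, k3.2.2, (ξ.continuousAt hξ).eventually a5] with z z1 z2 z3 z4
    rw [z2, z1, z4, z3]
  · rintro x a α b β c γ ⟨a1, a2, φ, χ, a3, a4, a5⟩ h1 ⟨c1, c2, φ₂, χ₂, c3, c4, c5⟩ hh
    rw [a4.self_of_nhds] at h1
    have key := f.tri a3 h1 c3 (by
      refine hj.eventually_map.2 ?_
      filter_upwards [c4, hh, a4] with y y1 y2 y3
      rw [← y1, y2, y3])
    rw [e, Filter.EventuallyEq, hj'.eventually_map] at key
    filter_upwards [key, c5, a5] with z z1 z2 z3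
    rw [z2, z1, z3]

end Pullback

section Maps

variable {n n' n'' : ℕ} {Q Q' Q'' : Type u} [TopologicalSpace Q] [TopologicalSpace Q']
  [TopologicalSpace Q''] {O : OrbifoldStructure n Q} {O' : OrbifoldStructure n' Q'}
  {O'' : OrbifoldStructure n'' Q''} {A : OrbAtlas O} {B : OrbAtlas O'} {C : OrbAtlas O''}

/-! ### Maps between disjoint unions of charts -/

/-- Charts are connected and the pieces of the disjoint union are clopen, so each chart lands in a
single piece. -/
theorem exists_eq_sigmaMap {ψ : A.Total → B.Total} (hψ : Continuous ψ) :
    ∃ (idx : A.ι → B.ι) (lift : ∀ i, (A.chart i).V → (B.chart (idx i)).V),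
      ψ = Sigma.map idx lift := by
  have h : ∀ i, ∃ j, ∀ x : (A.chart i).V, ∃ y : (B.chart j).V, ψ ⟨i, x⟩ = ⟨j, y⟩ := by
    intro i
    obtain ⟨x₀⟩ := (A.chart i).connectedV.toNonempty
    refine ⟨(ψ ⟨i, x₀⟩).1, fun x => ?_⟩
    have hc : Continuous fun x : (A.chart i).V => ψ ⟨i, x⟩ := hψ.comp continuous_sigmaMk
    have ho : IsClopen (Set.range (Sigma.mk (ψ ⟨i, x₀⟩).1 : _ → B.Total)) :=
      ⟨isClosed_range_sigmaMk, isOpen_range_sigmaMk⟩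
    have hp := (ho.preimage hc).eq_univ ⟨x₀, (ψ ⟨i, x₀⟩).2, rfl⟩
    obtain ⟨y, hy⟩ : x ∈ (fun x : (A.chart i).V => ψ ⟨i, x⟩) ⁻¹'
      Set.range (Sigma.mk (ψ ⟨i, x₀⟩).1 : _ → B.Total) := hp ▸ Set.mem_univ x
    exact ⟨y, hy.symm⟩
  choose idx lift hl using h
  exact ⟨idx, lift, funext fun x => hl x.1 x.2⟩

variable {idx : A.ι → B.ι} {lift : ∀ i, (A.chart i).V → (B.chart (idx i)).V}

theorem contMDiff_sigmaMap_iff : ContMDiff (𝓡 n) (𝓡 n') ∞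
    (Sigma.map idx lift : A.Total → B.Total) ↔ ∀ i, ContMDiff (𝓡 n) (𝓡 n') ∞ (lift i) := by
  constructor
  · intro h i x
    have h1 : ContMDiffAt (𝓡 n') (𝓡 n') ∞ (B.incl (idx i)).symm ⟨idx i, lift i x⟩ :=
      (B.contMDiffOn_incl_symm _ _ (B.mk_mem_incl_target _ _)).contMDiffAt
        ((B.incl _).open_target.mem_nhds (B.mk_mem_incl_target _ _))
    have h0 : ContMDiffAt (𝓡 n) (𝓡 n) ∞
        (fun y : (A.chart i).V => (⟨i, y⟩ : A.Total)) x :=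
      (contMDiff_sigmaMk (M := fun i => (A.chart i).V) i).contMDiffAt
    have h2 : ContMDiffAt (𝓡 n) (𝓡 n') ∞
        ((Sigma.map idx lift : A.Total → B.Total) ∘ Sigma.mk i) x :=
      ContMDiffAt.comp x (h ⟨i, x⟩) h0
    have h3 := ContMDiffAt.comp x h1 h2
    refine h3.congr_of_eventuallyEq (Filter.Eventually.of_forall fun y => ?_)
    exact (B.incl_symm_mk _ _).symm
  · rintro h ⟨i, x⟩
    refine contMDiffAt_sigma_iff.2 ?_
    exact (contMDiff_sigmaMk (idx i) _).comp x (h i x)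

end Maps

section Etale

variable {n : ℕ} {Q : Type u} [TopologicalSpace Q] {O : OrbifoldStructure n Q}
  {A B : OrbAtlas O} {idx : A.ι → B.ι} {lift : ∀ i, (A.chart i).V → (B.chart (idx i)).V}

theorem isEtale_sigmaMap (h : ∀ i, IsLocalDiffeomorph (𝓡 n) (𝓡 n) ∞ (lift i))
    (hp : ∀ i x, (B.chart (idx i)).π (lift i x) = (A.chart i).π x) :
    IsEtale (Sigma.map idx lift : A.Total → B.Total) := by
  rintro ⟨i, x⟩
  obtain ⟨Φ, hx, he⟩ := h i x
  refine ⟨Trn.ofCharts i (idx i) Φ.toOpenPartialHomeomorph Φ.contMDiffOn_toFun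
    Φ.contMDiffOn_invFun fun z hz => ?_, Trn.mem_ofCharts_src hx, fun y hy => ?_⟩
  · rw [← hp]
    exact congrArg _ (he hz).symm
  · obtain ⟨z, hz, rfl⟩ := Trn.exists_of_mem_ofCharts_src hy
    exact (congrArg (Sigma.mk (idx i)) (he hz)).trans (Trn.ofCharts_apply z).symm

theorem IsEtale.isLocalDiffeomorph (h : IsEtale (Sigma.map idx lift : A.Total → B.Total))
    (i : A.ι) : IsLocalDiffeomorph (𝓡 n) (𝓡 n) ∞ (lift i) := by
  intro x
  obtain ⟨e, hx, he⟩ := h ⟨i, x⟩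
  let Φ := (A.incl i).trans (e.toOPH.trans (B.incl (idx i)).symm)
  have hval : ∀ y : (A.chart i).V, (⟨i, y⟩ : A.Total) ∈ e.src →
      e ⟨i, y⟩ = ⟨idx i, lift i y⟩ := fun y hy => (he _ hy).symm
  have hsrc : ∀ y, y ∈ Φ.source → (⟨i, y⟩ : A.Total) ∈ e.src := fun y hy => hy.2.1
  refine ⟨⟨Φ.toPartialEquiv, Φ.open_source, Φ.open_target, ?_, ?_⟩, ?_, fun y hy => ?_⟩
  · have q : ContMDiffOn (𝓡 n) (𝓡 n) ∞ (fun y => (B.incl (idx i)).symm (e y))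
        (e.toOPH.trans (B.incl (idx i)).symm).source :=
      (B.contMDiffOn_incl_symm _).comp (e.smooth.mono fun y hy => hy.1) fun y hy => hy.2
    exact q.comp ((A.contMDiffOn_incl i).mono fun y hy => hy.1) fun y hy => hy.2
  · have q : ContMDiffOn (𝓡 n) (𝓡 n) ∞ (fun y => (A.incl i).symm (e.symm y))
        ((A.incl i).trans e.toOPH).target :=
      (A.contMDiffOn_incl_symm _).comp (e.smooth_symm.mono fun y hy => hy.1) fun y hy => hy.2
    exact q.comp ((B.contMDiffOn_incl (idx i)).mono fun y hy => trivial)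
      fun y hy => ⟨hy.1.2, hy.2⟩
  · refine ⟨trivial, hx, ?_⟩
    change e ⟨i, x⟩ ∈ (B.incl (idx i)).target
    rw [hval x hx]
    exact B.mk_mem_incl_target _ _
  · change lift i y = (B.incl (idx i)).symm (e ⟨i, y⟩)
    rw [hval y (hsrc y hy), B.incl_symm_mk]

end Etale

section Maps

variable {n n' n'' : ℕ} {Q Q' Q'' : Type u} [TopologicalSpace Q] [TopologicalSpace Q']
  [TopologicalSpace Q''] {O : OrbifoldStructure n Q} {O' : OrbifoldStructure n' Q'}
  {O'' : OrbifoldStructure n'' Q''} {A : OrbAtlas O} {B : OrbAtlas O'} {C : OrbAtlas O''}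

/-! ### Charted maps as assignments of germs -/

/-- An element of `Ψ(𝒱)` as a transition. -/
def Trn.ofPsi (φ : OpenPartialHomeomorph A.Total A.Total) (h : φ ∈ A.Psi) : Trn A A :=
  ⟨φ, h.1, h.2.1, h.2.2⟩

theorem Trn.mem_Psi (φ : Trn A A) : φ.toOPH ∈ A.Psi := ⟨φ.smooth, φ.smooth_symm, φ.proj⟩

namespace OrbMapRep

/-- The relation between germs given by `ν`. -/
def rel (r : OrbMapRep A B) : GRel A A B B := fun x φ χ =>
  x ∈ φ.src ∧ r.total x ∈ χ.src ∧ ∃ l ∈ r.P, x ∈ l.source ∧ φ =ᶠ[𝓝 x] l ∧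
    χ =ᶠ[𝓝 (r.total x)] r.ν l

theorem isGermRel_rel (r : OrbMapRep A B) : IsGermRel r.total r.total r.rel where
  mem h := h.1
  mem' h := h.2.1
  map_eq := by
    rintro x φ χ ⟨-, -, l, hl, hx, h1, h2⟩
    rw [h1.eq_of_nhds, h2.eq_of_nhds]
    exact (r.ν_equivariant l hl x hx).2.symm
  exists_rel := by
    intro x φ hx
    obtain ⟨l, hl, hxl, he⟩ := r.generates.2 φ.toOPH φ.mem_Psi x hx
    exact ⟨Trn.ofPsi (r.ν l) (r.ν_embedding l hl).1, hx, (r.ν_equivariant l hl x hxl).1,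
      l, hl, hxl, he, Filter.EventuallyEq.refl _ _⟩
  congr := by
    rintro x φ χ φ' χ' ⟨-, -, l, hl, hx, h1, h2⟩ hx' hφ hχ' hχ
    exact ⟨hx', hχ', l, hl, hx, hφ.trans h1, hχ.trans h2⟩
  eventually := by
    rintro x φ χ ⟨k1, k2, l, hl, hx, h1, h2⟩
    have hc := r.continuous_total.continuousAt (x := x)
    filter_upwards [φ.eventually_mem_src k1, hc.eventually (χ.eventually_mem_src k2),
      l.open_source.mem_nhds hx, h1.eventually_nhds, hc.eventually h2.eventually_nhds]
      with y y1 y2 y3 y4 y5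
    exact ⟨y1, y2, l, hl, y3, y4, y5⟩

theorem tri_rel (r : OrbMapRep A B) : Tri r.total r.rel r.rel r.rel := by
  rintro x a α b β c γ ⟨a1, a2, l, hl, a3, a4, a5⟩ ⟨b1, b2, m, hm, b3, b4, b5⟩
    ⟨c1, c2, k, hk, c3, c4, c5⟩ h
  have hax : l x = a x := a4.eq_of_nhds.symm
  have key := r.ν_mul l hl m hm x a3 (hax ▸ b3) k hk c3 (by
    filter_upwards [c4, h, a4, (a.continuousAt a1).eventually b4] with y y1 y2 y3 y4
    rw [← y1, y2, y4, y3, Function.comp_apply])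
  have hα : α (r.total x) = r.total (a x) := by
    rw [a5.eq_of_nhds, ← hax]
    exact (r.ν_equivariant l hl x a3).2.symm
  rw [← hα] at b5
  have key' : r.ν k =ᶠ[𝓝 (r.total x)] r.ν m ∘ r.ν l := key
  filter_upwards [c5, key', a5, (α.continuousAt a2).eventually b5] with z z1 z2 z3 z4
  rw [z1, z2, z4, z3, Function.comp_apply]

/-- The assignment of germs of a representative. -/
def toGMap (r : OrbMapRep A B) : GMap A B where
  toFun := r.toFun
  tot := r.total
  rel := r.rel
  continuous_toFun := r.continuous_toFun
  continuous_tot := r.continuous_total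
  proj_tot x := r.proj_lift x.1 x.2
  isGermRel := r.isGermRel_rel
  tri := r.tri_rel

/-- The relation of a representative is saturated under equality of germs and defined on all
transitions, so it no longer sees the choice of `P`. -/
theorem toGMap_eq_iff {r s : OrbMapRep A B} : r.toGMap = s.toGMap ↔ r ≈ s := by
  constructor
  · intro h
    refine ⟨congrArg GMap.toFun h, congrArg GMap.tot h, fun f hf g hg x hx hfg => ?_⟩
    have h1 : r.rel x (Trn.ofPsi f (r.generates.1 hf))
        (Trn.ofPsi (r.ν f) (r.ν_embedding f hf).1) :=
      ⟨hx.1, (r.ν_equivariant f hf x hx.1).1, f, hf, hx.1, Filter.EventuallyEq.refl _ _,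
        Filter.EventuallyEq.refl _ _⟩
    have h2 : s.rel = r.rel := (congrArg GMap.rel h).symm
    have h3 : r.total = s.total := congrArg GMap.tot h
    rw [← h2] at h1
    obtain ⟨-, -, l, hl, k1, k2, k3⟩ := h1
    rw [h3]
    exact k3.trans (s.ν_germ l hl g hg x ⟨k1, hx.2⟩ (k2.symm.trans hfg))
  · rintro ⟨h1, h2, h3⟩
    refine GMap.ext_of_le h1 h2 ?_
    rintro x φ χ ⟨k1, k2, l, hl, k3, k4, k5⟩
    obtain ⟨m, hm, hxm, he⟩ := s.generates.2 l (r.generates.1 hl) x k3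
    change s.rel x φ χ
    refine ⟨k1, ?_, m, hm, hxm, k4.trans he, ?_⟩
    · rw [← h2]; exact k2
    · rw [← h2]; exact k5.trans (h3 l hl m hm x ⟨k3, hxm⟩ he)

theorem toGMap_comp (s : OrbMapRep B C) (r : OrbMapRep A B) :
    (comp s r).toGMap = s.toGMap.comp r.toGMap := by
  refine GMap.ext_of_le rfl rfl ?_
  rintro x φ χ ⟨k1, k2, l, hl, k3, k4, k5⟩
  obtain ⟨μ, ξ, L, e⟩ := exists_link hl
  change χ =ᶠ[_] compν r s l at k5
  rw [e] at k5
  obtain ⟨a1, a2⟩ := L.2.2.2.2 x k3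
  refine ⟨Trn.ofPsi ξ (s.generates.1 L.2.1), ⟨k1, a1, μ, L.1, L.2.2.1 k3, k4.trans (L.germ k3),
    a2.symm⟩, a1, k2, ξ, L.2.1, a1, Filter.EventuallyEq.refl _ _, k5⟩

end OrbMapRep

/-- All inverses and composites already lie in `A.Psi`, and every germ of `A.Psi` is a germ of an
element of `P`. -/
theorem Generates.isQuasiPseudogroup {P : Set (OpenPartialHomeomorph A.Total A.Total)}
    (h : Generates P A.Psi) : IsQuasiPseudogroup P := by
  refine ⟨fun f hf x hx => ?_, fun f hf g hg x hx hgx => ?_⟩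
  · obtain ⟨g, hg, hxg, he⟩ := h.2 _ (Trn.ofPsi f (h.1 hf)).symm.mem_Psi (f x) (f.map_source hx)
    exact ⟨g, hg, hxg, he.symm⟩
  · obtain ⟨k, hk, hxk, he⟩ := h.2 _
      ((Trn.ofPsi f (h.1 hf)).trans (Trn.ofPsi g (h.1 hg))).mem_Psi x
      (Trn.mem_trans_src (φ := Trn.ofPsi f (h.1 hf)) (χ := Trn.ofPsi g (h.1 hg)) hx hgx)
    exact ⟨k, hk, hxk, he.symm⟩

namespace GMap

/-- The changes of charts whose germs are all assigned germs of one embedding of a chart. -/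
def goodChanges (G : GMap A B) : Set (OpenPartialHomeomorph A.Total A.Total) :=
  {l | A.IsChangeOfCharts l ∧ ∃ (φ : Trn A A) (χ : Trn B B), φ.toOPH = l ∧
    B.IsChartEmbedding χ.toOPH ∧ ∀ x ∈ l.source, G.rel x φ χ}

theorem exists_mem_goodChanges (G : GMap A B) {x : A.Total} {φ : Trn A A} (hx : x ∈ φ.src) :
    ∃ g ∈ G.goodChanges, x ∈ g.source ∧ φ =ᶠ[𝓝 x] g := by
  obtain ⟨χ, h⟩ := G.isGermRel.exists_rel hx
  have hχ := G.isGermRel.mem' h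
  -- The assigned transition is cut down to a small embedded chart that it maps into one chart, so
  -- that its restriction is an embedding of charts.
  have hU : χ.src ∩ χ ⁻¹' Set.range (Sigma.mk (χ (G.tot x)).1) ∈ 𝓝 (G.tot x) :=
    Filter.inter_mem (χ.src_mem_nhds hχ) ((χ.continuousAt hχ).preimage_mem_nhds
      (isOpen_range_sigmaMk.mem_nhds ⟨_, rfl⟩))
  obtain ⟨d, hd, e, he, hm, hs⟩ := B.exists_small_chart (G.tot x) hU
  set N : Set B.Total := Sigma.mk (G.tot x).1 '' Set.range e with hN
  have oN : IsOpen N :=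
    Topology.IsOpenEmbedding.sigmaMk.isOpenMap _ he.1.isOpen_range
  have hsrc : (χ.restr N oN).src = N := by
    rw [Trn.restr_src]
    exact Set.inter_eq_right.2 fun z hz => (hs hz).1
  have hemb : B.IsChartEmbedding (χ.restr N oN).toOPH := by
    refine ⟨Trn.mem_Psi _, ⟨_, d, hd, e, he, hsrc⟩, (χ (G.tot x)).1, ?_⟩
    intro z hz
    have hz' := (χ.restr N oN).symm_apply_mem_src hz
    rw [hsrc] at hz'
    have e1 := (χ.restr N oN).apply_symm_apply hz
    rw [Trn.restr_apply] at e1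
    have := (hs hz').2
    rwa [Set.mem_preimage, e1] at this
  have hV := G.isGermRel.eventually h
  obtain ⟨V, hV, oV, hxV⟩ := eventually_nhds_iff.1 (hV.and
    (G.continuous_tot.continuousAt.eventually (oN.mem_nhds hm)))
  -- On `V` the same `χ` stays assigned to `φ` and `G.tot` has values in `N`; the other factors make
  -- the restriction of `φ` a change of charts.
  set U : Set A.Total := V ∩ Set.range (Sigma.mk x.1) ∩
    (φ.src ∩ φ ⁻¹' Set.range (Sigma.mk (φ x).1)) with hUdef
  have oU : IsOpen U := (oV.inter isOpen_range_sigmaMk).inter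
    (φ.toOPH.isOpen_inter_preimage isOpen_range_sigmaMk)
  have hxU : x ∈ U := ⟨⟨hxV, x.2, rfl⟩, hx, (φ x).2, rfl⟩
  have hsrcU : (φ.restr U oU).src = U := by
    rw [Trn.restr_src]
    exact Set.inter_eq_right.2 fun z hz => hz.2.1
  refine ⟨(φ.restr U oU).toOPH, ⟨⟨Trn.mem_Psi _, ⟨x.1, ?_⟩, (φ x).1, ?_⟩, φ.restr U oU,
    χ.restr N oN, rfl, hemb, ?_⟩, ?_, Filter.EventuallyEq.refl _ _⟩
  · intro z hz
    have hz : z ∈ U := hsrcU ▸ hz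
    exact hz.1.2
  · intro z hz
    have hz' := (φ.restr U oU).symm_apply_mem_src hz
    rw [hsrcU] at hz'
    have e1 := (φ.restr U oU).apply_symm_apply hz
    rw [Trn.restr_apply] at e1
    have := hz'.2.2
    rwa [Set.mem_preimage, e1] at this
  · intro z hz
    have hz' : z ∈ U := hsrcU ▸ hz
    obtain ⟨h1, h2⟩ := hV z hz'.1.1
    refine G.isGermRel.congr h1 hz (Filter.EventuallyEq.refl _ _) ?_ (Filter.EventuallyEq.refl _ _)
    rw [hsrc]
    exact h2
  · change x ∈ (φ.restr U oU).src
    rw [hsrcU]; exact hxU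

theorem generates_goodChanges (G : GMap A B) : Generates G.goodChanges A.Psi :=
  ⟨fun _ h => h.1.1, fun f hf _ hx => G.exists_mem_goodChanges (φ := Trn.ofPsi f hf) hx⟩

open Classical in
/-- A choice of the embeddings assigned to the good changes of charts. -/
noncomputable def goodν (G : GMap A B) (l : OpenPartialHomeomorph A.Total A.Total) :
    OpenPartialHomeomorph B.Total B.Total :=
  if h : l ∈ G.goodChanges then h.2.choose_spec.choose.toOPH else OpenPartialHomeomorph.refl _

theorem goodν_spec (G : GMap A B) {l : OpenPartialHomeomorph A.Total A.Total}
    (h : l ∈ G.goodChanges) : ∃ (φ : Trn A A) (χ : Trn B B), φ.toOPH = l ∧ χ.toOPH = G.goodν l ∧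
      B.IsChartEmbedding χ.toOPH ∧ ∀ x ∈ l.source, G.rel x φ χ := by
  have hs := h.2.choose_spec.choose_spec
  exact ⟨_, _, hs.1, by rw [goodν, dif_pos h], hs.2⟩

/-- A representative of a charted map with a given assignment of germs. -/
noncomputable def toRep (G : GMap A B) (idx : A.ι → B.ι)
    (lift : ∀ i, (A.chart i).V → (B.chart (idx i)).V)
    (smooth : ∀ i, ContMDiff (𝓡 n) (𝓡 n') ∞ (lift i)) (ht : G.tot = Sigma.map idx lift) :
    OrbMapRep A B where
  toFun := G.toFun
  continuous_toFun := G.continuous_toFun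
  idx := idx
  lift := lift
  smooth_lift := smooth
  proj_lift i x := by
    have := G.proj_tot ⟨i, x⟩
    rwa [ht] at this
  P := G.goodChanges
  change_of_charts _ h := h.1
  quasi := G.generates_goodChanges.isQuasiPseudogroup
  generates := G.generates_goodChanges
  ν := G.goodν
  ν_embedding f hf := by
    obtain ⟨φ, χ, -, h2, h3, -⟩ := G.goodν_spec hf
    exact h2 ▸ h3
  ν_equivariant f hf x hx := by
    obtain ⟨φ, χ, rfl, h2, -, h4⟩ := G.goodν_spec hf
    rw [← ht, ← h2]
    exact ⟨G.isGermRel.mem' (h4 x hx), (G.isGermRel.map_eq (h4 x hx)).symm⟩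
  ν_germ f hf g hg x hx hfg := by
    obtain ⟨φ, χ, rfl, h2, -, h4⟩ := G.goodν_spec hf
    obtain ⟨φ', χ', rfl, h2', -, h4'⟩ := G.goodν_spec hg
    rw [← ht, ← h2, ← h2']
    exact G.isCell_rel.germ_unique (h4 x hx.1) (h4' x hx.2) hfg
  ν_mul f hf g hg x hx hgx h hh hxh he := by
    obtain ⟨φ₁, χ₁, rfl, h2, -, h4⟩ := G.goodν_spec hf
    obtain ⟨φ₂, χ₂, rfl, h2', -, h4'⟩ := G.goodν_spec hg
    obtain ⟨φ₃, χ₃, rfl, h2'', -, h4''⟩ := G.goodν_spec hh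
    rw [← ht, ← h2, ← h2', ← h2'']
    exact G.tri (h4 x hx) (h4' _ hgx) (h4'' x hxh) he
  ν_unit f hf x hx he := by
    obtain ⟨φ, χ, rfl, h2, -, h4⟩ := G.goodν_spec hf
    rw [← ht, ← h2]
    exact G.rel_unit (h4 x hx) he

theorem toGMap_toRep (G : GMap A B) (idx : A.ι → B.ι)
    (lift : ∀ i, (A.chart i).V → (B.chart (idx i)).V)
    (smooth : ∀ i, ContMDiff (𝓡 n) (𝓡 n') ∞ (lift i)) (ht : G.tot = Sigma.map idx lift) :
    (G.toRep idx lift smooth ht).toGMap = G := by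
  refine GMap.ext_of_le rfl ht.symm ?_
  rintro x φ χ ⟨k1, k2, l, hl, k3, k4, k5⟩
  obtain ⟨φ', χ', rfl, h2, -, h4⟩ := G.goodν_spec hl
  have k2' : G.tot x ∈ χ.src := by rw [ht]; exact k2
  have k5' : χ =ᶠ[𝓝 (G.tot x)] χ' := by rw [ht, h2]; exact k5
  exact G.isGermRel.congr (h4 x k3) k1 k4 k2' k5'

end GMap

namespace ChartedMap

/-- The assignment of germs of a charted map. -/
def toGMap (f : ChartedMap A B) : GMap A B :=
  Quotient.lift OrbMapRep.toGMap (fun _ _ h => OrbMapRep.toGMap_eq_iff.2 h) f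

theorem toGMap_injective : Function.Injective (toGMap : ChartedMap A B → GMap A B) := by
  intro f g
  induction f using Quotient.ind
  induction g using Quotient.ind
  exact fun h => Quotient.sound (OrbMapRep.toGMap_eq_iff.1 h)

theorem toGMap_comp (g : ChartedMap B C) (f : ChartedMap A B) :
    (g.comp f).toGMap = g.toGMap.comp f.toGMap := by
  induction f using Quotient.ind
  induction g using Quotient.ind
  exact OrbMapRep.toGMap_comp _ _

theorem contMDiff_tot (f : ChartedMap A B) : ContMDiff (𝓡 n) (𝓡 n') ∞ f.toGMap.tot := by
  induction f using Quotient.ind with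
  | _ r => exact contMDiff_sigmaMap_iff.2 r.smooth_lift

/-- Together with `toGMap_injective` this identifies charted maps with smooth assignments of germs,
so charted maps may be built from germs alone. -/
theorem exists_toGMap_eq (G : GMap A B) (h : ContMDiff (𝓡 n) (𝓡 n') ∞ G.tot) :
    ∃ f : ChartedMap A B, f.toGMap = G := by
  obtain ⟨idx, lift, ht⟩ := exists_eq_sigmaMap G.continuous_tot
  rw [ht, contMDiff_sigmaMap_iff] at h
  exact ⟨Quotient.mk _ (G.toRep idx lift h ht), G.toGMap_toRep idx lift h ht⟩

theorem IsLiftOfId.exists_eq_ofEtale {A B : OrbAtlas O} {ε : ChartedMap A B}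
    (h : ε.IsLiftOfId) : ∃ hε : IsEtale ε.toGMap.tot, ε.toGMap = GMap.ofEtale _ hε := by
  obtain ⟨r, rfl, h1, h2⟩ := h
  have hε : IsEtale r.toGMap.tot := isEtale_sigmaMap h2 fun i x => by
    rw [r.proj_lift, h1, id]
  exact ⟨hε, GMap.eq_ofEtale h1 hε⟩

theorem exists_isLiftOfId {A B : OrbAtlas O} {ψ : A.Total → B.Total} (h : IsEtale ψ) :
    ∃ ε : ChartedMap A B, ε.IsLiftOfId ∧ ε.toGMap = GMap.ofEtale ψ h := by
  obtain ⟨idx, lift, ht⟩ := exists_eq_sigmaMap h.continuous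
  subst ht
  have hs := contMDiff_sigmaMap_iff.1 h.contMDiff
  refine ⟨Quotient.mk _ ((GMap.ofEtale _ h).toRep idx lift hs rfl), ⟨_, rfl, rfl, ?_⟩,
    GMap.toGMap_toRep _ idx lift hs rfl⟩
  exact h.isLocalDiffeomorph

end ChartedMap

end Maps

/-! ### Refinements of atlases -/

section Refinement

variable {n : ℕ} {Q : Type u} [TopologicalSpace Q] {O : OrbifoldStructure n Q}

/-- An atlas has refinements by small charts around prescribed points. -/
theorem OrbAtlas.exists_refinement (A : OrbAtlas O) {κ : Type u} (p : κ → A.Total)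
    (hp : ∀ q, ∃ k, A.proj (p k) = q) (U : κ → Set A.Total) (hU : ∀ k, U k ∈ 𝓝 (p k)) :
    ∃ (W : OrbAtlas O) (j : W.Total → A.Total) (lbl : W.Total → κ), IsEtale j ∧
      (∀ w, ∀ᶠ v in 𝓝 w, lbl v = lbl w) ∧ (∀ w, j w ∈ U (lbl w)) ∧
      (∀ v w, lbl v = lbl w → j v = j w → v = w) ∧
      ∀ k, ∀ᶠ y in 𝓝 (p k), ∃ w, lbl w = k ∧ j w = y := by
  choose d hd e he hm hs using fun k => A.exists_small_chart (p k) (hU k)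
  let W : OrbAtlas O :=
    { ι := κ
      chart := d
      chart_mem := hd
      cover := fun q => by
        obtain ⟨k, rfl⟩ := hp q
        obtain ⟨_, ⟨s, rfl⟩, hk⟩ := hm k
        refine ⟨k, s, ?_⟩
        rw [← (he k).2.2 s]
        exact congrArg A.proj hk }
  let j : W.Total → A.Total := Sigma.map (fun k => (p k).1) e
  refine ⟨W, j, Sigma.fst, isEtale_sigmaMap (fun k => (he k).2.1) (fun k => (he k).2.2), ?_, ?_,
    ?_, ?_⟩
  · rintro ⟨k, s⟩
    filter_upwards [isOpen_range_sigmaMk.mem_nhds ⟨s, rfl⟩] with v hv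
    obtain ⟨t, rfl⟩ := hv
    rfl
  · rintro ⟨k, s⟩
    exact hs k ⟨_, ⟨s, rfl⟩, rfl⟩
  · rintro ⟨k, s⟩ ⟨k', t⟩ h1 h2
    obtain rfl : k = k' := h1
    have h3 : (⟨(p k).1, e k s⟩ : A.Total) = ⟨(p k).1, e k t⟩ := h2
    rw [(he k).1.injective (eq_of_heq (Sigma.mk.inj h3).2)]
  · intro k
    have oN : IsOpen (Sigma.mk (p k).1 '' Set.range (e k)) :=
      (Topology.IsOpenEmbedding.sigmaMk (σ := fun i => (A.chart i).V)).isOpenMap _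
        (he k).1.isOpen_range
    filter_upwards [oN.mem_nhds (hm k)] with y hy
    obtain ⟨_, ⟨s, rfl⟩, rfl⟩ := hy
    exact ⟨⟨k, s⟩, rfl, rfl⟩

theorem isEtale_of_eventuallyEq_comp {A A' W : OrbAtlas O} {j : W.Total → A.Total}
    {j' : W.Total → A'.Total} (hj : IsEtale j)
    (h : ∀ w, ∃ a : Trn A A', j w ∈ a.src ∧ ∀ᶠ v in 𝓝 w, j' v = a (j v)) : IsEtale j' := by
  refine isEtale_of_eventuallyEq fun w => ?_
  obtain ⟨a, ha, he⟩ := h w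
  obtain ⟨e, hw, k, ke⟩ := hj.exists_trn w
  refine ⟨e.trans a, Trn.mem_trans_src hw (k ▸ ha), ?_⟩
  filter_upwards [he, ke] with v h1 h2
  rw [h1, h2, Trn.trans_apply]

end Refinement

/-! ### Refinements adapted to chosen transitions -/

section Maps

variable {n n' n'' : ℕ} {Q Q' Q'' : Type u} [TopologicalSpace Q] [TopologicalSpace Q']
  [TopologicalSpace Q''] {O : OrbifoldStructure n Q} {O' : OrbifoldStructure n' Q'}
  {O'' : OrbifoldStructure n'' Q''}

/-- A charted map is induced on refinements of its atlases, which can be chosen so fine that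
prescribed families of transitions assemble to lifts of the identity. -/
theorem ChartedMap.exists_refinement {A A₂ : OrbAtlas O} {B B₂ : OrbAtlas O'}
    (f : ChartedMap A B) (U : A.Total → Set A.Total) (hU : ∀ x, U x ∈ 𝓝 x)
    (a : A.Total → Trn A A₂) (ha : ∀ x, x ∈ (a x).src)
    (e : A.Total → Trn B B₂) (he : ∀ x, f.toGMap.tot x ∈ (e x).src) :
    ∃ (W : OrbAtlas O) (W' : OrbAtlas O') (ε₁ : ChartedMap W A) (ε₂ : ChartedMap W A₂)
      (ε₁' : ChartedMap W' B) (ε₂' : ChartedMap W' B₂) (h : ChartedMap W W'),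
      ε₁.IsLiftOfId ∧ ε₂.IsLiftOfId ∧ ε₁'.IsLiftOfId ∧ ε₂'.IsLiftOfId ∧
      f.comp ε₁ = ε₁'.comp h ∧ ∀ w, ∃ x, ε₁.toGMap.tot w ∈ U x ∧
        (∀ᶠ v in 𝓝 w, ε₂.toGMap.tot v = a x (ε₁.toGMap.tot v)) ∧
        ∀ᶠ z in 𝓝 (h.toGMap.tot w), ε₂'.toGMap.tot z = e x (ε₁'.toGMap.tot z) := by
  set ψ := f.toGMap.tot with hψ
  have hψc : Continuous ψ := f.toGMap.continuous_tot
  have hcov : ∀ y : B.Total, ∃ t : Trn B B₂, y ∈ t.src := fun y => by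
    obtain ⟨z, hz⟩ := B₂.exists_proj_eq (B.proj y)
    obtain ⟨t, ht, -⟩ := Trn.exists_of_proj_eq y z hz.symm
    exact ⟨t, ht⟩
  choose t ht using hcov
  -- The left summand provides, for each `x`, a chart around `ψ x` on which `e x` is defined. The
  -- right summand, with arbitrary transitions `t`, makes the charts cover the whole target
  -- orbifold.
  let e' : A.Total ⊕ B.Total → Trn B B₂ := Sum.elim e t
  let p' : A.Total ⊕ B.Total → B.Total := Sum.elim ψ id
  obtain ⟨W', j', l', hj', hl', hm', hi', hn'⟩ := B.exists_refinement p'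
    (fun q => by
      obtain ⟨y, hy⟩ := B.exists_proj_eq q
      exact ⟨Sum.inr y, hy⟩) (fun k => (e' k).src) (by
      rintro (x | y)
      · exact (e x).src_mem_nhds (he x)
      · exact (t y).src_mem_nhds (ht y))
  obtain ⟨W, j, l, hj, hl, hm, hi, hn⟩ := A.exists_refinement id A.exists_proj_eq
    -- The last condition makes `ψ` map the chart labelled `x` into the image of the chart of `W'`
    -- labelled `Sum.inl x`, so that `ψ` lifts to `W'`.
    (fun x => U x ∩ (a x).src ∩ {y | ∃ w', l' w' = Sum.inl x ∧ j' w' = ψ y}) (fun x =>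
      Filter.inter_mem (Filter.inter_mem (hU x) ((a x).src_mem_nhds (ha x)))
        (hψc.continuousAt.eventually (hn' (Sum.inl x))))
  choose η hη₁ hη₂ using fun w => (hm w).2
  -- The pointwise choice `η` is locally `q⁻¹ ∘ ψ ∘ j`, because a point of `W'` is determined by its
  -- label and its image under `j'`. Smoothness of `η` follows.
  have hloc : ∀ w, ∃ q : Trn W' B, η w ∈ q.src ∧ j w ∈ ψ ⁻¹' q.symm.src ∧
      ∀ᶠ v in 𝓝 w, η v = q.symm (ψ (j v)) := by
    intro w
    obtain ⟨q, hq, hqe⟩ := hj' (η w)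
    have h1 : ψ (j w) = q (η w) := by rw [← hη₂, hqe _ hq]
    have h2 : ψ (j w) ∈ q.symm.src := h1 ▸ q.apply_mem_symm_src hq
    have hc : ContinuousAt (fun v => ψ (j v)) w := (hψc.comp hj.continuous).continuousAt
    have hc' : Filter.Tendsto (fun v => q.symm (ψ (j v))) (𝓝 w) (𝓝 (η w)) := by
      have h3 := ContinuousAt.comp (f := fun v => ψ (j v)) (q.symm.continuousAt h2) hc
      rw [ContinuousAt, Function.comp_apply, h1, q.symm_apply_apply hq] at h3
      exact h3
    refine ⟨q, hq, h2, ?_⟩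
    filter_upwards [hl w, hc.eventually (q.symm.eventually_mem_src h2), hc'.eventually (hl' _)]
      with v v1 v2 v3
    refine hi' _ _ ?_ ?_
    · rw [v3, hη₁, hη₁, v1]
    · rw [hη₂, hqe _ (q.symm_apply_mem_src v2), q.apply_symm_apply v2]
  have hηs : ContMDiff (𝓡 n) (𝓡 n') ∞ η := fun w => by
    obtain ⟨q, -, h2, h3⟩ := hloc w
    have hψj : ContMDiffAt (𝓡 n) (𝓡 n') ∞ (ψ ∘ j) w :=
      (f.contMDiff_tot (j w)).comp w (hj.contMDiff w)
    exact (ContMDiffAt.comp w (q.symm.contMDiffAt h2) hψj).congr_of_eventuallyEq h3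
  obtain ⟨ε₁, lε₁, gε₁⟩ := ChartedMap.exists_isLiftOfId hj
  obtain ⟨ε₁', lε₁', gε₁'⟩ := ChartedMap.exists_isLiftOfId hj'
  -- The labels are locally constant, so locally a single transition `a x` is used. The same holds
  -- for `e'` on `W'`.
  have hj₂ : IsEtale fun w => a (l w) (j w) := isEtale_of_eventuallyEq_comp hj fun w =>
    ⟨a (l w), (hm w).1.2, (hl w).mono fun v hv => by rw [hv]⟩
  have hj₂' : IsEtale fun w => e' (l' w) (j' w) := isEtale_of_eventuallyEq_comp hj' fun w =>
    ⟨e' (l' w), hm' w, (hl' w).mono fun v hv => by rw [hv]⟩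
  obtain ⟨ε₂, lε₂, gε₂⟩ := ChartedMap.exists_isLiftOfId hj₂
  obtain ⟨ε₂', lε₂', gε₂'⟩ := ChartedMap.exists_isLiftOfId hj₂'
  obtain ⟨h, gh⟩ := ChartedMap.exists_toGMap_eq
    (f.toGMap.pullback η hj hj' hηs.continuous hη₂) hηs
  refine ⟨W, W', ε₁, ε₂, ε₁', ε₂', h, lε₁, lε₂, lε₁', lε₂', ?_, fun w => ⟨l w, ?_, ?_, ?_⟩⟩
  · apply ChartedMap.toGMap_injective
    rw [ChartedMap.toGMap_comp, ChartedMap.toGMap_comp, gε₁, gε₁', gh]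
    exact GMap.comp_pullback hj hj' hηs.continuous hη₂
  · rw [gε₁]; exact (hm w).1.1
  · rw [gε₁, gε₂]
    filter_upwards [hl w] with v hv
    change a (l v) (j v) = a (l w) (j v)
    rw [hv]
  · rw [gε₁', gε₂', gh]
    change ∀ᶠ z in 𝓝 (η w), e' (l' z) (j' z) = e (l w) (j' z)
    filter_upwards [hl' (η w)] with z hz
    rw [hz, hη₁]
    rfl

/-- If `f₁` and `h` correspond under lifts of the identity, and these differ from another pair of
lifts of the identity by an isomorphism from `f₁` to `f₂`, then `f₂` and `h` correspond under the
latter. -/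
theorem IsCell.comp_eq {A₁ A₂ W : OrbAtlas O} {B₁ B₂ W' : OrbAtlas O'} {f₁ : GMap A₁ B₁}
    {f₂ : GMap A₂ B₂} {h : GMap W W'} {T : GRel A₁ A₂ B₁ B₂} (hT : IsCell f₁ f₂ T)
    {j₁ : W.Total → A₁.Total} {j₂ : W.Total → A₂.Total} {j₁' : W'.Total → B₁.Total}
    {j₂' : W'.Total → B₂.Total} (hj₁ : IsEtale j₁) (hj₂ : IsEtale j₂) (hj₁' : IsEtale j₁')
    (hj₂' : IsEtale j₂')
    (H : f₁.comp (GMap.ofEtale j₁ hj₁) = (GMap.ofEtale j₁' hj₁').comp h)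
    (hw : ∀ w, ∃ a χ, T (j₁ w) a χ ∧ (∀ᶠ v in 𝓝 w, j₂ v = a (j₁ v)) ∧
      ∀ᶠ z in 𝓝 (h.tot w), j₂' z = χ (j₁' z)) :
    f₂.comp (GMap.ofEtale j₂ hj₂) = (GMap.ofEtale j₂' hj₂').comp h := by
  have e : ∀ x, f₁.tot (j₁ x) = j₁' (h.tot x) := congrFun (congrArg GMap.tot H)
  have e₂ : ∀ x, f₂.tot (j₂ x) = j₂' (h.tot x) := by
    intro w
    obtain ⟨a, χ, h1, h2, h3⟩ := hw w
    rw [h2.self_of_nhds, h3.self_of_nhds, ← hT.map_eq h1, e]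
  have ht : ((GMap.ofEtale j₂' hj₂').comp h).tot = (f₂.comp (GMap.ofEtale j₂ hj₂)).tot :=
    (funext e₂).symm
  have hf : ((GMap.ofEtale j₂' hj₂').comp h).toFun =
      (f₂.comp (GMap.ofEtale j₂ hj₂)).toFun := by
    have := congrArg GMap.toFun H
    rw [show (f₂.comp (GMap.ofEtale j₂ hj₂)).toFun = (f₁.comp (GMap.ofEtale j₁ hj₁)).toFun from
      hT.toFun_eq.symm, this]
    rfl
  symm
  refine GMap.ext_of_le hf ht ?_
  rintro w φ χ₂ ⟨χ, k1, k2⟩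
  obtain ⟨φ₁, k3⟩ := (isGermRel_liftRel hj₁).exists_rel (h.isGermRel.mem k1)
  obtain ⟨χ₁, k4⟩ := f₁.isGermRel.exists_rel k3.2.1
  have k5 := GMap.liftRel_of_comp_eq hj₁ hj₁' H k3 k4 k1
  obtain ⟨φ₂, k6⟩ := (isGermRel_liftRel hj₂).exists_rel (h.isGermRel.mem k1)
  obtain ⟨ξ, k7⟩ := f₂.isGermRel.exists_rel k6.2.1
  obtain ⟨a, α, h1, h2, h3⟩ := hw w
  obtain ⟨b, β, h1', h2', h3'⟩ := hw (φ w)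
  rw [← show φ₁ (j₁ w) = j₁ (φ w) from k3.2.2.self_of_nhds] at h1'
  rw [← h.isGermRel.map_eq k1] at h3'
  -- A naturality square: the germs of `b ∘ φ₁` and `φ₂ ∘ a` agree, so the assigned germ `ρ` is both
  -- `β ∘ χ₁` and `ξ ∘ α`.
  obtain ⟨ρ, hρ⟩ := hT.exists_rel (φ := φ₁.trans b)
    (Trn.mem_trans_src k3.2.1 (hT.mem h1'))
  have q1 := hT.left k4 h1' hρ (Filter.EventuallyEq.refl _ _)
  have k7' : f₂.rel (a (j₁ w)) φ₂ ξ := by rw [← h2.self_of_nhds]; exact k7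
  have q2 := hT.right h1 k7' hρ (by
    refine hj₁.eventually_map.2 ?_
    filter_upwards [k3.2.2, h2, k6.2.2, (φ.continuousAt k3.1).eventually h2'] with v v1 v2 v3 v4
    rw [Trn.trans_apply, v1, ← v4, ← v3, v2])
  rw [e, Filter.EventuallyEq, hj₁'.eventually_map] at q1 q2
  have q3 : χ₂ =ᶠ[𝓝 (j₂' (h.tot w))] ξ := by
    refine hj₂'.eventually_map.2 ?_
    filter_upwards [q1, q2, h3, k5.2.2, k2.2.2, (χ.continuousAt k2.1).eventually h3']
      with z z1 z2 z3 z4 z5 z6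
    rw [z5, z6, ← z4, ← z1, z2, z3]
  rw [← e₂] at q3
  refine ⟨φ₂, k6, f₂.isGermRel.congr k7 k6.2.1 (Filter.EventuallyEq.refl _ _) ?_ q3⟩
  have := k2.2.1
  change j₂' (h.tot w) ∈ χ₂.src at this
  rw [← e₂] at this
  exact this

theorem GMap.ofEtale_id_comp {A : OrbAtlas O} {B : OrbAtlas O'} (f : GMap A B) :
    (GMap.ofEtale id IsEtale.isEtale_id).comp f = f := by
  refine GMap.ext_of_le rfl rfl ?_
  rintro x φ χ ⟨ξ, h1, h2⟩
  exact f.isGermRel.congr h1 (f.isGermRel.mem h1) (Filter.EventuallyEq.refl _ _) h2.2.1 h2.2.2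

/-! ### Equivalence of charted maps -/

namespace AnyChartedMap

/-- Two charted maps are isomorphic if the associated assignments of germs are. -/
def Iso (f g : AnyChartedMap O O') : Prop := ∃ T, IsCell f.map.toGMap g.map.toGMap T

theorem Iso.refl (f : AnyChartedMap O O') : f.Iso f := ⟨_, f.map.toGMap.isCell_rel⟩

theorem Iso.symm {f g : AnyChartedMap O O'} : f.Iso g → g.Iso f := fun ⟨_, h⟩ => ⟨_, h.symm⟩

theorem Iso.trans {f g h : AnyChartedMap O O'} : f.Iso g → g.Iso h → f.Iso h :=
  fun ⟨_, h⟩ ⟨_, k⟩ => ⟨_, h.trans k⟩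

theorem iso_of_comp_eq {A W : OrbAtlas O} {B W' : OrbAtlas O'} {f : ChartedMap A B}
    {h : ChartedMap W W'} {ε : ChartedMap W A} {ε' : ChartedMap W' B} (hε : ε.IsLiftOfId)
    (hε' : ε'.IsLiftOfId) (H : f.comp ε = ε'.comp h) :
    Iso ⟨W, W', h⟩ (⟨A, B, f⟩ : AnyChartedMap O O') := by
  obtain ⟨h1, k1⟩ := hε.exists_eq_ofEtale
  obtain ⟨h2, k2⟩ := hε'.exists_eq_ofEtale
  have := congrArg ChartedMap.toGMap H
  rw [ChartedMap.toGMap_comp, ChartedMap.toGMap_comp, k1, k2] at this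
  exact exists_isCell_of_comp_eq h1 h2 this

/-- Transitivity of `Sim` is not visible from its definition, while cells compose. A common `h` is
isomorphic to both maps; conversely, germs of a cell chosen at every point become lifts of the
identity on a fine enough refinement. -/
theorem sim_iff_iso {f g : AnyChartedMap O O'} : f.Sim g ↔ f.Iso g := by
  constructor
  · rintro ⟨W, W', ε₁, ε₂, ε₁', ε₂', h, l₁, l₂, l₁', l₂', H₁, H₂⟩
    exact (iso_of_comp_eq l₁ l₁' H₁).symm.trans (iso_of_comp_eq l₂ l₂' H₂)
  · rintro ⟨T, hT⟩
    have hex : ∀ x : f.dom.Total, ∃ (a : Trn f.dom g.dom) (χ : Trn f.ran g.ran),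
        T x a χ := fun x => by
      obtain ⟨y, hy⟩ := g.dom.exists_proj_eq (f.dom.proj x)
      obtain ⟨a, ha, -⟩ := Trn.exists_of_proj_eq x y hy.symm
      exact ⟨a, hT.exists_rel ha⟩
    choose a χ haχ using hex
    -- The prescribed neighbourhood of `x` is where the cell still relates `a x` to `χ x`, as
    -- `IsCell.comp_eq` requires.
    obtain ⟨W, W', ε₁, ε₂, ε₁', ε₂', h, l₁, l₂, l₁', l₂', H₁, hw⟩ := f.map.exists_refinement
      (fun x => {y | T y (a x) (χ x)}) (fun x => hT.eventually (haχ x)) a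
      (fun x => hT.mem (haχ x)) χ (fun x => hT.mem' (haχ x))
    refine ⟨W, W', ε₁, ε₂, ε₁', ε₂', h, l₁, l₂, l₁', l₂', H₁, ?_⟩
    obtain ⟨e₁, k₁⟩ := l₁.exists_eq_ofEtale
    obtain ⟨e₂, k₂⟩ := l₂.exists_eq_ofEtale
    obtain ⟨e₁', k₁'⟩ := l₁'.exists_eq_ofEtale
    obtain ⟨e₂', k₂'⟩ := l₂'.exists_eq_ofEtale
    have H := congrArg ChartedMap.toGMap H₁
    rw [ChartedMap.toGMap_comp, ChartedMap.toGMap_comp, k₁, k₁'] at H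
    apply ChartedMap.toGMap_injective
    rw [ChartedMap.toGMap_comp, ChartedMap.toGMap_comp, k₂, k₂']
    refine hT.comp_eq e₁ e₂ e₁' e₂' H fun w => ?_
    obtain ⟨x, h1, h2, h3⟩ := hw w
    exact ⟨a x, χ x, h1, h2, h3⟩

theorem toMorph_eq_iff {f g : AnyChartedMap O O'} : f.toMorph = g.toMorph ↔ f.Iso g := by
  constructor
  · intro h
    have : g ∈ g.cls := sim_iff_iso.2 (Iso.refl g)
    rw [← show f.cls = g.cls from congrArg Subtype.val h] at this
    exact sim_iff_iso.1 this
  · intro h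
    refine Subtype.ext (Set.ext fun k => ?_)
    change f.Sim k ↔ g.Sim k
    rw [sim_iff_iso, sim_iff_iso]
    exact ⟨h.symm.trans, h.trans⟩

end AnyChartedMap

theorem OrbMorph.exists_mem (F : OrbMorph O O') : ∃ f, f ∈ F.1 := by
  obtain ⟨_, f, rfl⟩ := F
  exact ⟨f, AnyChartedMap.sim_iff_iso.2 (AnyChartedMap.Iso.refl f)⟩

theorem OrbMorph.iso_of_mem {F : OrbMorph O O'} {f g : AnyChartedMap O O'} (hf : f ∈ F.1)
    (hg : g ∈ F.1) : f.Iso g := by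
  obtain ⟨_, k, rfl⟩ := F
  exact (AnyChartedMap.sim_iff_iso.1 hf).symm.trans (AnyChartedMap.sim_iff_iso.1 hg)

/-- Transitions from the range atlas of `f` to the domain atlas of `g`, chosen around the points in
the image of `f`, yield a refinement `K'` with lifts of the identity to both atlases. On the side of
`g` nothing is refined: `K''` is its range atlas, `ε''` the identity and `k` is `g ∘ ε₂'`. -/
theorem CompChoice.nonempty (f : AnyChartedMap O O') (g : AnyChartedMap O' O'') :
    Nonempty (CompChoice f g) := by
  have hex : ∀ x : f.dom.Total, ∃ e : Trn f.ran g.dom, f.map.toGMap.tot x ∈ e.src := fun x => by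
    obtain ⟨z, hz⟩ := g.dom.exists_proj_eq (f.ran.proj (f.map.toGMap.tot x))
    obtain ⟨e, he, -⟩ := Trn.exists_of_proj_eq _ z hz.symm
    exact ⟨e, he⟩
  choose e he using hex
  obtain ⟨W, W', ε₁, -, ε₁', ε₂', h, l₁, -, l₁', l₂', H, -⟩ := f.map.exists_refinement
    (fun _ => Set.univ) (fun _ => Filter.univ_mem) (fun _ => Trn.refl _) Trn.mem_refl_src e he
  obtain ⟨ε'', l'', k''⟩ := ChartedMap.exists_isLiftOfId (IsEtale.isEtale_id (A := g.ran))
  refine ⟨⟨W, W', g.ran, ε₁, ε₁', ε₂', ε'', h, g.map.comp ε₂', l₁, l₁', l₂', l'', H, ?_⟩⟩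
  apply ChartedMap.toGMap_injective
  rw [ChartedMap.toGMap_comp ε'', k'', GMap.ofEtale_id_comp]

/-- The two `h` are isomorphic through `f₁` and `f₂`, the two `k` through `g₁` and `g₂`; these cells
compose horizontally even though the middle atlases differ. -/
theorem CompChoice.result_iso {f₁ f₂ : AnyChartedMap O O'} {g₁ g₂ : AnyChartedMap O' O''}
    (hf : f₁.Iso f₂) (hg : g₁.Iso g₂) (D₁ : CompChoice f₁ g₁) (D₂ : CompChoice f₂ g₂) :
    D₁.result.Iso D₂.result := by
  have h : AnyChartedMap.Iso ⟨D₁.K, D₁.K', D₁.h⟩ ⟨D₂.K, D₂.K', D₂.h⟩ :=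
    ((AnyChartedMap.iso_of_comp_eq D₁.isLift_ε D₁.isLift_ε₁' D₁.comm_f).trans hf).trans
      (AnyChartedMap.iso_of_comp_eq D₂.isLift_ε D₂.isLift_ε₁' D₂.comm_f).symm
  have k : AnyChartedMap.Iso ⟨D₁.K', D₁.K'', D₁.k⟩ ⟨D₂.K', D₂.K'', D₂.k⟩ :=
    ((AnyChartedMap.iso_of_comp_eq D₁.isLift_ε₂' D₁.isLift_ε'' D₁.comm_g).trans hg).trans
      (AnyChartedMap.iso_of_comp_eq D₂.isLift_ε₂' D₂.isLift_ε'' D₂.comm_g).symm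
  obtain ⟨T, hT⟩ := h
  obtain ⟨S, hS⟩ := k
  have := hS.comp hT
  rw [← ChartedMap.toGMap_comp, ← ChartedMap.toGMap_comp] at this
  exact ⟨_, this⟩

end Maps

end RedOrb

theorem mainTheorem5 {n n' n'' : ℕ} {Q Q' Q'' : Type u}
    [TopologicalSpace Q] [T2Space Q] [SecondCountableTopology Q]
    [TopologicalSpace Q'] [T2Space Q'] [SecondCountableTopology Q']
    [TopologicalSpace Q''] [T2Space Q''] [SecondCountableTopology Q'']
    (O : RedOrb.OrbifoldStructure n Q) (O' : RedOrb.OrbifoldStructure n' Q')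
    (O'' : RedOrb.OrbifoldStructure n'' Q'') :
    (∀ (f : RedOrb.AnyChartedMap O O') (g : RedOrb.AnyChartedMap O' O''),
      Nonempty (RedOrb.CompChoice f g)) ∧
    ∃! c : RedOrb.OrbMorph O' O'' → RedOrb.OrbMorph O O' → RedOrb.OrbMorph O O'',
      ∀ (G : RedOrb.OrbMorph O' O'') (F : RedOrb.OrbMorph O O'), ∀ f ∈ F.1, ∀ g ∈ G.1,
        ∀ D : RedOrb.CompChoice f g, c G F = D.result.toMorph := by
  refine ⟨RedOrb.CompChoice.nonempty, fun G F =>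
    (RedOrb.CompChoice.nonempty F.exists_mem.choose G.exists_mem.choose).some.result.toMorph,
    fun G F f hf g hg D => ?_, fun c hc => ?_⟩
  · exact RedOrb.AnyChartedMap.toMorph_eq_iff.2 (RedOrb.CompChoice.result_iso
      (RedOrb.OrbMorph.iso_of_mem F.exists_mem.choose_spec hf)
      (RedOrb.OrbMorph.iso_of_mem G.exists_mem.choose_spec hg) _ D)
  -- Representatives and choices exist for every pair of classes, so the condition prescribes each
  -- value.
  · funext G F
    exact hc G F _ F.exists_mem.choose_spec _ G.exists_mem.choose_spec _
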